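/- **Conventions.** For a nonsingular real $2\times 2$ matrix $M$, let $\mathbb T_M=\mathbb R^2/\Gamma_M$ be the flat torus, where $\Gamma_M$ is the lattice generated by the columns of $M$; $\mathbb T_\square=\mathbb T_I$ is the square flat torus. A *geodesic graph* $G$ on $\mathbb T_M$ is a finite graph (loops and parallel edges allowed) embedded on $\mathbb T_M$ so that each edge is the projection of a line segment of $\mathbb R^2$ and each face is an open disk. Each edge consists of two opposite darts; the displacement vector $\Delta_d\in\mathbb R^2$ of a dart $d$ is head minus tail of any lift of $d$ to the plane. * An *equilibrium stress* of $G$ is a vector $\omega\in\mathbb R^E$ with $\sum_{d:\,\mathrm{tail}(d)=p}\omega_d\,\Delta_d=0$ for every vertex $p$; $G$ is an *equilibrium graph* if it has an equilibrium stress with $\omega_e>0$ for all $e$. * The *dual graph* $G^*$ has the faces of $G$ as vertices and one edge $e^*$, joining the two faces at $e$, for each edge $e$. A geodesic embedding of $G^*$ on the same torus is *dual to* $G$ if it is homotopic to (and has the same orientation as) the natural embedding, with each dual vertex inside its face and each $e^*$ crossing only $e$, once. $G$ is *reciprocal* on $\mathbb T_M$ if it has a dual geodesic embedding on $\mathbb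 T_M$ with $e\perp e^*$ for all $e$; then $\omega_e=|e^*|/|e|$ is called a *reciprocal stress* of $G$. * $G$ is *coherent* on $\mathbb T_M$ if for some vertex weights $\pi\in\mathbb R^V$ it is the weighted Delaunay graph of its vertices, that is: whenever $p\to q,\ p\to r,\ p\to s$ are consecutive darts in counterclockwise order around their tail $p$, the determinant with the three rows $\bigl(\Delta x_{p\to t},\ \Delta y_{p\to t},\ \tfrac12\|\Delta_{p\to t}\|^2+\pi_p-\pi_t\bigr)$, $t=q,r,s$, is positive; and all diagonals of non-triangular faces are locally flat, that is, for any four vertices of a face of the universal cover, the determinant with rows $\bigl(1,\ x_t,\ y_t,\ \tfrac12(x_t^2+y_t^2)-\pi_t\bigr)$ vanishes. For a positive integer $k$, let $G_k$ be the geodesic graph on $\mathbb T_\square$ with vertices $(i/k,j/k)$, $i,j\in\mathbb Z/k$, where at each vertex starts one edge with each of the displacement vectors $(1/k,0)$, $(1/k,1/k)$, $(2/k,1/k)$. Thus $G_1$ is the one-vertex triangulation with edge vectors $(1,0),(1,1),(2,1)$, and $G_k$ is its $k\times k$ cover. **Theorem.** Not every positive equilibrium stress is a reciprocal stress and, more generally,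 not every equilibrium graph on a flat torus is reciprocal or coherent on that torus. Precisely: 1. For every $k\ge 1$, $G_k$ is a geodesic graph on $\mathbb T_\square$ (a cellular embedding). Every stress on $G_k$ that takes equal values on edges with equal displacement vectors is an equilibrium stress; in particular, every stress on $G_1$ is one, and $G_k$ has positive equilibrium stresses. But no stress on $G_k$ is a reciprocal stress, and $G_k$ is neither reciprocal nor coherent on $\mathbb T_\square$. 2. On every flat torus $\mathbb T_M$ ($\det M\neq0$) there is a geodesic equilibrium graph that is neither reciprocal nor coherent on $\mathbb T_M$, and that has a positive equilibrium stress which is not a reciprocal stress. -/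

import Mathlib

noncomputable section

open Filter Topology

/-- The Euclidean plane. -/
abbrev Plane : Type := EuclideanSpace ℝ (Fin 2)

/-- The counterclockwise rotation by a right angle. -/
def rot90 (v : Plane) : Plane := !₂[-(v 1), v 0]

/-- The counterclockwise rotation by the angle `θ`. -/
def rotate (θ : ℝ) (v : Plane) : Plane := Real.cos θ • v + Real.sin θ • rot90 v

/-- The group of translations generated by the columns of `M`. -/
def lattice (M : Matrix (Fin 2) (Fin 2) ℝ) : AddSubgroup Plane :=
  AddSubgroup.closure (Set.range fun j : Fin 2 => (!₂[M 0 j, M 1 j] : Plane))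

/-- The flat torus of a (nonsingular) matrix `M`: the quotient of the plane by the lattice
generated by the columns of `M`, with the quotient topology. The flat torus of the identity matrix
is the square flat torus. -/
abbrev FlatTorus (M : Matrix (Fin 2) (Fin 2) ℝ) : Type := Plane ⧸ lattice M

/-- The covering map from the plane to the flat torus. -/
def toTorus (M : Matrix (Fin 2) (Fin 2) ℝ) (x : Plane) : FlatTorus M := QuotientAddGroup.mk x

/-- A geodesic drawing of a finite graph (loops and parallel edges allowed) on the flat torus of
`M`. Each edge `e` has a reference dart from `src e` to `tgt e`, drawn as the projection of a
segment in the plane whose displacement vector is `disp e`. -/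
structure GeodesicGraph (M : Matrix (Fin 2) (Fin 2) ℝ) where
  V : Type
  E : Type
  [fintypeV : Fintype V]
  [fintypeE : Fintype E]
  src : E → V
  tgt : E → V
  pos : V → FlatTorus M
  disp : E → Plane
  pos_tgt : ∀ e, pos (tgt e) = pos (src e) + toTorus M (disp e)

attribute [instance] GeodesicGraph.fintypeV GeodesicGraph.fintypeE

namespace GeodesicGraph

variable {M : Matrix (Fin 2) (Fin 2) ℝ}

/-- The point at parameter `t` of the (geodesic) edge `e`. -/
def edgePoint (G : GeodesicGraph M) (e : G.E) (t : ℝ) : FlatTorus M :=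
  G.pos (G.src e) + toTorus M (t • G.disp e)

/-- The drawing is injective: vertices are distinct points, and edges are simple paths with
disjoint interiors that avoid the vertices. -/
def IsEmbedding (G : GeodesicGraph M) : Prop :=
  Function.Injective G.pos ∧
  (∀ e e' : G.E, ∀ t ∈ Set.Ioo (0 : ℝ) 1, ∀ t' ∈ Set.Ioo (0 : ℝ) 1,
    G.edgePoint e t = G.edgePoint e' t' → e = e' ∧ t = t') ∧
  (∀ (e : G.E) (v : G.V), ∀ t ∈ Set.Ioo (0 : ℝ) 1, G.edgePoint e t ≠ G.pos v)

/-- The image of the drawing on the torus. -/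
def image (G : GeodesicGraph M) : Set (FlatTorus M) :=
  Set.range G.pos ∪ {y | ∃ e : G.E, ∃ t ∈ Set.Icc (0 : ℝ) 1, y = G.edgePoint e t}

/-- The faces: the connected components of the complement of the image on the torus. -/
def Face (G : GeodesicGraph M) : Type :=
  {F : Set (FlatTorus M) // ∃ x ∈ G.imageᶜ, F = connectedComponentIn G.imageᶜ x}

/-- The image of the universal cover, in the plane. -/
def coverImage (G : GeodesicGraph M) : Set Plane := toTorus M ⁻¹' G.image

/-- The faces of the universal cover: the connected components, in the plane, of the complement
of its image. -/
def CoverFace (G : GeodesicGraph M) : Type :=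
  {F : Set Plane // ∃ x ∈ G.coverImageᶜ, F = connectedComponentIn G.coverImageᶜ x}

/-- All faces are open disks. -/
def IsCellular (G : GeodesicGraph M) : Prop :=
  ∀ F : G.Face, Nonempty (F.1 ≃ₜ Metric.ball (0 : Plane) 1)

/-- A geodesic graph on the flat torus, in the strict sense: a cellular geodesic embedding. -/
def IsTorusGraph (G : GeodesicGraph M) : Prop := G.IsEmbedding ∧ G.IsCellular

/-! ### Darts and their cyclic order around a vertex -/

/-- The darts: `(e, true)` is the reference dart of the edge `e` and `(e, false)` its reversal. -/
abbrev Dart (G : GeodesicGraph M) : Type := G.E × Bool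

/-- The reversal of a dart. -/
def rev (G : GeodesicGraph M) (d : G.Dart) : G.Dart := (d.1, !d.2)

/-- The tail of a dart. -/
def tail (G : GeodesicGraph M) (d : G.Dart) : G.V := if d.2 then G.src d.1 else G.tgt d.1

/-- The head of a dart. -/
def head (G : GeodesicGraph M) (d : G.Dart) : G.V := if d.2 then G.tgt d.1 else G.src d.1

/-- The displacement vector of a dart. -/
def dartDisp (G : GeodesicGraph M) (d : G.Dart) : Plane :=
  if d.2 then G.disp d.1 else -G.disp d.1

/-- `b` has the direction of `a` rotated counterclockwise by `θ`, and the same tail. -/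
def AtAngle (G : GeodesicGraph M) (a b : G.Dart) (θ : ℝ) : Prop :=
  G.tail a = G.tail b ∧ ∃ r : ℝ, 0 < r ∧ G.dartDisp b = r • rotate θ (G.dartDisp a)

/-- `b` is the first dart met when turning counterclockwise from `a` around their common tail (it
is `a` itself, after a full turn, if `a` is the only dart with this tail). -/
def CcwNext (G : GeodesicGraph M) (a b : G.Dart) : Prop :=
  ∃ θ : ℝ, 0 < θ ∧ θ ≤ 2 * Real.pi ∧ G.AtAngle a b θ ∧
    ∀ θ' : ℝ, 0 < θ' → θ' < θ → ∀ d : G.Dart, ¬ G.AtAngle a d θ'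

/-! ### Equilibrium stresses -/

open Classical in
/-- At every vertex, the displacement vectors of the outgoing darts, weighted by the stress
coefficients of their edges, add up to zero. -/
def IsEquilibriumStress (G : GeodesicGraph M) (ω : G.E → ℝ) : Prop :=
  ∀ p : G.V, ∑ d : G.Dart with G.tail d = p, ω d.1 • G.dartDisp d = 0

/-- A geodesic graph is an equilibrium graph if it has a positive equilibrium stress. -/
def IsEquilibrium (G : GeodesicGraph M) : Prop :=
  ∃ ω : G.E → ℝ, (∀ e, 0 < ω e) ∧ G.IsEquilibriumStress ω

/-! ### Dual graphs and reciprocality -/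

/-- The face `F` of the universal cover lies immediately to the left of the lift of the reference
dart of `e` that starts at `x`. -/
def IsLeftFace (G : GeodesicGraph M) (e : G.E) (x : Plane) (F : G.CoverFace) : Prop :=
  ∀ᶠ ε : ℝ in 𝓝[>] 0, x + (1 / 2 : ℝ) • G.disp e + ε • rot90 (G.disp e) ∈ F.1

/-- The face `F` of the universal cover lies immediately to the right of the lift of the reference
dart of `e` that starts at `x`. -/
def IsRightFace (G : GeodesicGraph M) (e : G.E) (x : Plane) (F : G.CoverFace) : Prop :=
  ∀ᶠ ε : ℝ in 𝓝[>] 0, x + (1 / 2 : ℝ) • G.disp e - ε • rot90 (G.disp e) ∈ F.1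

/-- `H` is a geodesic drawing of the dual graph of `G`, in the homotopy class and with the
orientation of the natural one (dual vertices inside their faces, each dual edge crossing only its
primal edge).

* Vertices of `H` are the faces of `G`, edges of `H` are the edges of `G`; the dual of a dart `d`
  runs from the face to the right of `d` to the face to the left of `d`.
* Homotopy class: a homotopy of drawings on the torus is a homotopy of drawings in the plane that
  commutes with the lattice translations. So a drawing is homotopic to the natural one if and only
  if it has a lift to the plane which sends each face `F` of the universal cover of `G` to a lift
  `lift F` of the corresponding vertex of `H`, commutes with the lattice translations, and joins by
  dual edges the images of the faces on the two sides of each edge of the universal cover.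
* Orientation: as for the natural drawing, the counterclockwise order of the dual darts around a
  dual vertex is the counterclockwise order of the primal edges along the boundary of the
  face. In terms of darts with a common tail in `G`: if `a` follows `b` counterclockwise, then the
  face between them is to the right of `a` and of the reversal of `b`, and the dual of the
  reversal of `b` follows the dual of `a` counterclockwise. -/
structure Duality (G H : GeodesicGraph M) where
  face : G.Face ≃ H.V
  edge : G.E ≃ H.E
  lift : G.CoverFace → Plane
  toTorus_lift : ∀ (F : G.CoverFace) (f : G.Face), F.1 ⊆ toTorus M ⁻¹' f.1 →
    toTorus M (lift F) = H.pos (face f)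
  lift_translate : ∀ (F F' : G.CoverFace), ∀ l ∈ lattice M, F'.1 = (fun x => x + l) '' F.1 →
    lift F' = lift F + l
  dual_edge : ∀ (e : G.E) (x : Plane), toTorus M x = G.pos (G.src e) →
    ∃ (L R : G.CoverFace) (l r : G.Face), G.IsLeftFace e x L ∧ G.IsRightFace e x R ∧
      L.1 ⊆ toTorus M ⁻¹' l.1 ∧ R.1 ⊆ toTorus M ⁻¹' r.1 ∧
      H.src (edge e) = face r ∧ H.tgt (edge e) = face l ∧
      H.disp (edge e) = lift L - lift R
  orientation : ∀ a b : G.Dart, G.CcwNext b a →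
    H.CcwNext (edge a.1, a.2) (edge (G.rev b).1, (G.rev b).2)

/-- `H` is a geodesic embedding of the dual graph of `G` on the same flat torus, and each edge is
orthogonal to its dual edge (under the given correspondence `D`). -/
def IsReciprocalPair (G H : GeodesicGraph M) (D : G.Duality H) : Prop :=
  H.IsEmbedding ∧ ∀ e : G.E, inner ℝ (G.disp e) (H.disp (D.edge e)) = 0

/-- `G` is reciprocal on its flat torus. -/
def IsReciprocal (G : GeodesicGraph M) : Prop :=
  ∃ (H : GeodesicGraph M) (D : G.Duality H), G.IsReciprocalPair H D

/-- `ω` is a reciprocal stress: for some reciprocal graph on the same flat torus, `ω e` is the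
length of the dual edge of `e` divided by the length of `e`. -/
def IsReciprocalStress (G : GeodesicGraph M) (ω : G.E → ℝ) : Prop :=
  ∃ (H : GeodesicGraph M) (D : G.Duality H), G.IsReciprocalPair H D ∧
    ∀ e : G.E, ω e = ‖H.disp (D.edge e)‖ / ‖G.disp e‖

/-! ### Weighted Delaunay graphs -/

/-- The row of the local Delaunay determinant of the dart `d`, for vertex weights `w`. -/
def delaunayRow (G : GeodesicGraph M) (w : G.V → ℝ) (d : G.Dart) : Fin 3 → ℝ :=
  ![G.dartDisp d 0, G.dartDisp d 1,
    (1 / 2) * ‖G.dartDisp d‖ ^ 2 + w (G.tail d) - w (G.head d)]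

/-- The edge of `r` is locally Delaunay, tested at the tail of `r`: if `q`, `r`, `s` are
consecutive darts around their common tail, such that the face to the left of `q` is to the right
of `r` and the face to the left of `r` is to the right of `s`, then the determinant is positive. -/
def IsLocallyDelaunay (G : GeodesicGraph M) (w : G.V → ℝ) (r : G.Dart) : Prop :=
  ∀ q s : G.Dart, G.CcwNext q r → G.CcwNext r s →
    0 < (Matrix.of ![G.delaunayRow w q, G.delaunayRow w r, G.delaunayRow w s]).det

/-- Any four vertices of a common face of the universal cover have vanishing Delaunay determinant;
that is, all diagonals of all faces are locally flat. (For a triangular face there is nothing to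
check, since two of the four vertices coincide.) -/
def HasFlatDiagonals (G : GeodesicGraph M) (w : G.V → ℝ) : Prop :=
  ∀ (F : G.CoverFace) (v : Fin 4 → G.V) (x : Fin 4 → Plane),
    (∀ i, toTorus M (x i) = G.pos (v i) ∧ x i ∈ closure F.1) →
    (Matrix.of fun i : Fin 4 =>
      ![1, x i 0, x i 1, (1 / 2) * ‖x i‖ ^ 2 - w (v i)]).det = 0

/-- `G` is the weighted Delaunay graph of its vertices, for the vertex weights `w`. -/
def IsWeightedDelaunay (G : GeodesicGraph M) (w : G.V → ℝ) : Prop :=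
  (∀ r : G.Dart, G.IsLocallyDelaunay w r) ∧ G.HasFlatDiagonals w

/-- `G` is coherent on its flat torus. -/
def IsCoherent (G : GeodesicGraph M) : Prop := ∃ w : G.V → ℝ, G.IsWeightedDelaunay w

end GeodesicGraph

/-! ### The `k × k` covers of the one-vertex triangulation -/

/-- The displacement vectors of the three edges of the one-vertex triangulation. -/
def edgeVector : Fin 3 → Plane := ![!₂[1, 0], !₂[1, 1], !₂[2, 1]]

/-- The same three vectors as steps between the vertices of the `k × k` grid. -/
def edgeStep (k : ℕ) : Fin 3 → ZMod k × ZMod k := ![(1, 0), (1, 1), (2, 1)]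

/-- The point `(i / k, j / k)` of the square flat torus. -/
def gridPoint (k : ℕ) (v : ZMod k × ZMod k) : FlatTorus 1 :=
  toTorus 1 !₂[(v.1.val : ℝ) / k, (v.2.val : ℝ) / k]

theorem toTorus_one_eq {x y : Plane} (a b : ℤ) (h0 : y 0 = x 0 + a) (h1 : y 1 = x 1 + b) :
    toTorus 1 x = toTorus 1 y := by
  refine QuotientAddGroup.eq.mpr ?_
  have hm : ∀ j : Fin 2,
      (!₂[(1 : Matrix (Fin 2) (Fin 2) ℝ) 0 j, (1 : Matrix (Fin 2) (Fin 2) ℝ) 1 j] : Plane) ∈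
        lattice 1 := fun j => AddSubgroup.subset_closure ⟨j, rfl⟩
  have key := (lattice 1).add_mem ((lattice 1).zsmul_mem (hm 0) a) ((lattice 1).zsmul_mem (hm 1) b)
  convert key using 1
  ext i
  fin_cases i <;> simp [h0, h1]

theorem gridPoint_add_step (k : ℕ) [NeZero k] (v : ZMod k × ZMod k) (c : Fin 3) :
    gridPoint k (v + edgeStep k c) =
      gridPoint k v + toTorus 1 ((1 / (k : ℝ)) • edgeVector c) := by
  have hk : (k : ℝ) ≠ 0 := Nat.cast_ne_zero.mpr (NeZero.ne k)
  have key : ∀ (a : ZMod k) (m : ℕ),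
      ∃ z : ℤ, ((a.val : ℝ) + m) / k = ((a + m).val : ℝ) / k + z := by
    intro a m
    refine ⟨((a.val + m) / k : ℕ), ?_⟩
    have h : (a + m).val = (a.val + m) % k := by
      rw [← ZMod.val_natCast, Nat.cast_add, ZMod.natCast_zmod_val]
    have h2 : ((a.val + m : ℕ) : ℝ) = ((a.val + m) % k : ℕ) + k * ((a.val + m) / k : ℕ) := by
      exact_mod_cast (Nat.mod_add_div _ _).symm
    rw [h, Int.cast_natCast]
    push_cast at h2 ⊢
    rw [h2]
    field_simp
  change toTorus 1 _ = toTorus 1 (_ + _)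
  fin_cases c
  · obtain ⟨a, ha⟩ := key v.1 1
    obtain ⟨b, hb⟩ := key v.2 0
    refine toTorus_one_eq a b ?_ ?_
    · simp [edgeStep, edgeVector] at ha ⊢; rw [← ha]; ring
    · simp [edgeStep, edgeVector] at hb ⊢; linarith
  · obtain ⟨a, ha⟩ := key v.1 1
    obtain ⟨b, hb⟩ := key v.2 1
    refine toTorus_one_eq a b ?_ ?_
    · simp [edgeStep, edgeVector] at ha ⊢; rw [← ha]; ring
    · simp [edgeStep, edgeVector] at hb ⊢; rw [← hb]; ring
  · obtain ⟨a, ha⟩ := key v.1 2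
    obtain ⟨b, hb⟩ := key v.2 1
    refine toTorus_one_eq a b ?_ ?_
    · simp [edgeStep, edgeVector] at ha ⊢; rw [← ha]; ring
    · simp [edgeStep, edgeVector] at hb ⊢; rw [← hb]; ring

/-- The `k × k` cover of the one-vertex triangulation of the square flat torus with edge vectors
`(1, 0)`, `(1, 1)`, `(2, 1)` (the case `k = 1`), rescaled to the square flat torus: its preimage
under multiplication by `k` on the torus. The vertices form the regular `k × k` grid, and at each
vertex starts one edge with each of the displacement vectors `(1/k, 0)`, `(1/k, 1/k)`,
`(2/k, 1/k)`. -/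
def coverTriangulation (k : ℕ) [NeZero k] : GeodesicGraph 1 where
  V := ZMod k × ZMod k
  E := (ZMod k × ZMod k) × Fin 3
  fintypeV := inferInstance
  fintypeE := inferInstance
  src e := e.1
  tgt e := e.1 + edgeStep k e.2
  pos := gridPoint k
  disp e := (1 / (k : ℝ)) • edgeVector e.2
  pos_tgt e := gridPoint_add_step k e.1 e.2

end

noncomputable section

open Filter Topology

/-! ### Determinants and angles in the plane -/

/-! Everything is proved for one family, `gridTriangulation`: the grid spanned by vectors `a`, `b`
such that `k • a`, `k • b` is a basis of the lattice, with edges `a`, `b`, `a + b` starting at every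
vertex. The pair `a`, `b` is positively oriented and forms an acute angle, so `a + b` is the longer
diagonal of its parallelogram, the wrong one for a Delaunay triangulation. The graphs on the square
torus are the case of the identity map, and every flat torus has such a basis
(`nonempty_of_det_ne_zero`). Equal weights on parallel edges are in equilibrium because opposite
darts cancel at each vertex.

Coherence fails by averaging (`not_isCoherent`). Up to a positive factor, the local Delaunay
determinant at the diagonal from `v` is `-⟨a, b⟩` plus a mixed difference of the vertex weights.
Summed over the vertices of the torus, the weights cancel and `-⟨a, b⟩ > 0` remains.

Reciprocality fails by a monodromy argument (`not_isReciprocal`). Orthogonality makes each dual edge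
a multiple, of unknown sign, of the primal edge turned by a right angle. Along a horizontal strip of
triangles one crosses alternately edges parallel to `b` and to `a + b`. The homotopy class forces
the dual displacements over one period to add up to `-k • a` (`exists_strip`). Pairing this with `b`
and with `a + b` shows that the multiples on the diagonals have negative sum and those on the
`b`-edges positive sum. But the cyclic order around each dual vertex forces all these multiples to
have the same sign (`strip_mul_pos`). -/

/-- The determinant of two vectors of the plane. -/
def planeDet (u v : Plane) : ℝ := u 0 * v 1 - u 1 * v 0

theorem planeDet_add_left (u v w : Plane) : planeDet (u + v) w = planeDet u w + planeDet v w := by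
  simp [planeDet]; ring

theorem planeDet_add_right (u v w : Plane) : planeDet u (v + w) = planeDet u v + planeDet u w := by
  simp [planeDet]; ring

theorem planeDet_smul_left (r : ℝ) (u v : Plane) : planeDet (r • u) v = r * planeDet u v := by
  simp [planeDet]; ring

theorem planeDet_smul_right (r : ℝ) (u v : Plane) : planeDet u (r • v) = r * planeDet u v := by
  simp [planeDet]; ring

theorem planeDet_neg_left (u v : Plane) : planeDet (-u) v = -planeDet u v := by
  simp [planeDet]; ring

theorem planeDet_neg_right (u v : Plane) : planeDet u (-v) = -planeDet u v := by
  simp [planeDet]; ring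

theorem planeDet_self (u : Plane) : planeDet u u = 0 := by
  simp [planeDet]; ring

theorem planeDet_swap (u v : Plane) : planeDet u v = -planeDet v u := by
  simp [planeDet]; ring

theorem planeDet_rot90_rot90 (u v : Plane) : planeDet (rot90 u) (rot90 v) = planeDet u v := by
  simp [planeDet, rot90]; ring

theorem planeDet_rot90_self (u : Plane) : planeDet (rot90 u) u = -‖u‖ ^ 2 := by
  simp [planeDet, rot90, EuclideanSpace.norm_sq_eq]; ring

theorem plane_inner_eq (u v : Plane) : inner ℝ u v = u 0 * v 0 + u 1 * v 1 := by
  simp [PiLp.inner_apply, Fin.sum_univ_two]; ring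

theorem plane_norm_sq_eq (u : Plane) : ‖u‖ ^ 2 = u 0 ^ 2 + u 1 ^ 2 := by
  simp [EuclideanSpace.norm_sq_eq, Fin.sum_univ_two]

theorem planeDet_rotate_rotate (s t : ℝ) (u : Plane) :
    planeDet (rotate s u) (rotate t u) = Real.sin (t - s) * ‖u‖ ^ 2 := by
  rw [plane_norm_sq_eq, Real.sin_sub]
  simp [planeDet, rotate, rot90]; ring

theorem rotate_zero (u : Plane) : rotate 0 u = u := by simp [rotate]

theorem planeDet_rotate (t : ℝ) (u : Plane) :
    planeDet u (rotate t u) = Real.sin t * ‖u‖ ^ 2 := by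
  have h := planeDet_rotate_rotate 0 t u
  rwa [rotate_zero, sub_zero] at h

theorem norm_sq_pos_of_planeDet_ne_zero {u v : Plane} (h : planeDet u v ≠ 0) : 0 < ‖u‖ ^ 2 := by
  have : u ≠ 0 := by rintro rfl; simp [planeDet] at h
  positivity

/-- A vector on the left of `u` has the direction of `u` rotated by less than half a turn. -/
theorem exists_rotate_of_planeDet_pos {u v : Plane} (h : 0 < planeDet u v) :
    ∃ t : ℝ, 0 < t ∧ t < Real.pi ∧ ∃ r : ℝ, 0 < r ∧ v = r • rotate t u := by
  have hN := norm_sq_pos_of_planeDet_ne_zero h.ne'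
  set N := ‖u‖ ^ 2 with hNdef
  -- This is the quotient `v / u` of complex numbers; its argument is the angle sought.
  set z : ℂ := ⟨inner ℝ u v / N, planeDet u v / N⟩ with hz
  have him : 0 < z.im := div_pos h hN
  have hz0 : z ≠ 0 := fun h0 => by simp [h0] at him
  have hr : 0 < ‖z‖ := norm_pos_iff.mpr hz0
  have hs : ‖z‖ * Real.sin z.arg = planeDet u v / N := Complex.norm_mul_sin_arg z
  have hc : ‖z‖ * Real.cos z.arg = inner ℝ u v / N := Complex.norm_mul_cos_arg z
  have hsin : 0 < Real.sin z.arg := by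
    have : 0 < ‖z‖ * Real.sin z.arg := by rw [hs]; exact him
    exact pos_of_mul_pos_right this hr.le
  refine ⟨z.arg, ?_, ?_, ‖z‖, hr, ?_⟩
  · by_contra! hle
    exact hsin.not_ge (Real.sin_nonpos_of_nonpos_of_neg_pi_le hle (Complex.neg_pi_lt_arg z).le)
  · refine lt_of_le_of_ne (Complex.arg_le_pi z) fun he => ?_
    rw [he, Real.sin_pi] at hsin
    exact hsin.false
  · rw [rotate, smul_add, smul_smul, smul_smul, hs, hc, plane_inner_eq]
    have hN' : N = u 0 ^ 2 + u 1 ^ 2 := plane_norm_sq_eq u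
    have hN0 : u 0 ^ 2 + u 1 ^ 2 ≠ 0 := hN' ▸ hN.ne'
    ext i
    fin_cases i <;> simp [rot90, planeDet, hN'] <;> field_simp <;> ring

theorem exists_smul_rot90_of_inner_eq_zero {u v : Plane} (hu : u ≠ 0) (h : inner ℝ u v = 0) :
    ∃ c : ℝ, v = c • rot90 u := by
  have hN : 0 < ‖u‖ ^ 2 := by positivity
  have hN' : ‖u‖ ^ 2 = u 0 ^ 2 + u 1 ^ 2 := plane_norm_sq_eq u
  have hN0 : u 0 ^ 2 + u 1 ^ 2 ≠ 0 := hN' ▸ hN.ne'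
  rw [plane_inner_eq] at h
  refine ⟨planeDet u v / ‖u‖ ^ 2, ?_⟩
  ext i
  fin_cases i <;> simp [rot90, planeDet, hN'] <;> field_simp
  · linear_combination u 0 * h
  · linear_combination u 1 * h

namespace GeodesicGraph

variable {M : Matrix (Fin 2) (Fin 2) ℝ}

/-- The turn is less than half a turn, so a direction lies strictly between exactly when it is left
of the first dart and right of the second. Excluding such darts at all vertices, not only at the
common tail, costs nothing in a grid, where all vertices look alike. -/
theorem ccwNext_of_planeDet_pos (G : GeodesicGraph M) {d d' : G.Dart} (ht : G.tail d = G.tail d')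
    (h : 0 < planeDet (G.dartDisp d) (G.dartDisp d'))
    (hn : ∀ x : G.Dart, 0 < planeDet (G.dartDisp d) (G.dartDisp x) →
      ¬ 0 < planeDet (G.dartDisp x) (G.dartDisp d')) : G.CcwNext d d' := by
  obtain ⟨t, ht0, htpi, r, hr, hv⟩ := exists_rotate_of_planeDet_pos h
  have hN := norm_sq_pos_of_planeDet_ne_zero h.ne'
  refine ⟨t, ht0, by linarith [Real.pi_pos], ⟨ht, r, hr, hv⟩, ?_⟩
  rintro s hs hst x ⟨-, q, hq, hx⟩
  refine hn x ?_ ?_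
  · rw [hx, planeDet_smul_right, planeDet_rotate]
    have := Real.sin_pos_of_pos_of_lt_pi hs (hst.trans htpi)
    positivity
  · rw [hx, hv, planeDet_smul_left, planeDet_smul_right, planeDet_rotate_rotate]
    have := Real.sin_pos_of_pos_of_lt_pi (x := t - s) (by linarith) (by linarith)
    positivity

/-- If the next dart after `d` is reached after more than half a turn, then there is no dart on the
left of `d`. -/
theorem CcwNext.planeDet_nonpos {G : GeodesicGraph M} {d d' x : G.Dart} (hc : G.CcwNext d d')
    (h : planeDet (G.dartDisp d) (G.dartDisp d') < 0) (hx : G.tail d = G.tail x) :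
    planeDet (G.dartDisp d) (G.dartDisp x) ≤ 0 := by
  by_contra! hpos
  obtain ⟨t, ht0, ht2, ⟨-, r, hr, hv⟩, hn⟩ := hc
  obtain ⟨s, hs0, hspi, q, hq, hw⟩ := exists_rotate_of_planeDet_pos hpos
  refine hn s hs0 (hspi.trans ?_) x ⟨hx, q, hq, hw⟩
  by_contra! hle
  rw [hv, planeDet_smul_right, planeDet_rotate] at h
  have := Real.sin_nonneg_of_nonneg_of_le_pi ht0.le hle
  have : 0 ≤ r * (Real.sin t * ‖G.dartDisp d‖ ^ 2) := by positivity
  linarith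

/-- A null edge would be at the same point for the parameters `1/3` and `1/2`. Applied to the dual
graph, this makes the multiples of the rotated primal edges nonzero. -/
theorem IsEmbedding.disp_ne_zero {G : GeodesicGraph M} (h : G.IsEmbedding) (e : G.E) :
    G.disp e ≠ 0 := by
  intro h0
  have := (h.2.1 e e (1 / 3) (by norm_num) (1 / 2) (by norm_num) (by simp [edgePoint, h0])).2
  norm_num at this

end GeodesicGraph

/-! ### Coordinates with respect to a basis, and the triangles of a triangular grid -/

/-- The first coordinate with respect to the basis `a`, `b`. -/
def coordFst (a b : Plane) : Plane →ₗ[ℝ] ℝ where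
  toFun x := planeDet x b / planeDet a b
  map_add' x y := by rw [planeDet_add_left, add_div]
  map_smul' r x := by simp [planeDet_smul_left, mul_div_assoc]

/-- The second coordinate with respect to the basis `a`, `b`. -/
def coordSnd (a b : Plane) : Plane →ₗ[ℝ] ℝ where
  toFun x := planeDet a x / planeDet a b
  map_add' x y := by rw [planeDet_add_right, add_div]
  map_smul' r x := by simp [planeDet_smul_right, mul_div_assoc]

theorem coordFst_apply (a b x : Plane) : coordFst a b x = planeDet x b / planeDet a b := rfl

theorem coordSnd_apply (a b x : Plane) : coordSnd a b x = planeDet a x / planeDet a b := rfl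

theorem coordFst_left {a b : Plane} (h : planeDet a b ≠ 0) : coordFst a b a = 1 := div_self h

theorem coordSnd_right {a b : Plane} (h : planeDet a b ≠ 0) : coordSnd a b b = 1 := div_self h

theorem coord_smul_add_smul {a b : Plane} (h : planeDet a b ≠ 0) (x : Plane) :
    coordFst a b x • a + coordSnd a b x • b = x := by
  simp only [planeDet] at h
  ext i
  fin_cases i <;> simp [coordFst_apply, coordSnd_apply, planeDet] <;>
    rw [div_mul_eq_mul_div, div_mul_eq_mul_div, ← add_div, div_eq_iff h] <;> ring

theorem coordFst_right (a b : Plane) : coordFst a b b = 0 := by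
  simp [coordFst_apply, planeDet_self]

theorem coordSnd_left (a b : Plane) : coordSnd a b a = 0 := by
  simp [coordSnd_apply, planeDet_self]

theorem continuous_coordFst (a b : Plane) : Continuous (coordFst a b) :=
  LinearMap.continuous_of_finiteDimensional _

theorem continuous_coordSnd (a b : Plane) : Continuous (coordSnd a b) :=
  LinearMap.continuous_of_finiteDimensional _

/-- The open triangles cut out by the lines on which one of the coordinates, or their difference,
is an integer. -/
def gridTriangle (a b : Plane) (i j m : ℤ) : Set Plane :=
  {x | coordFst a b x ∈ Set.Ioo (i : ℝ) (i + 1) ∧ coordSnd a b x ∈ Set.Ioo (j : ℝ) (j + 1) ∧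
    (coordFst a b - coordSnd a b) x ∈ Set.Ioo (m : ℝ) (m + 1)}

theorem isOpen_gridTriangle (a b : Plane) (i j m : ℤ) : IsOpen (gridTriangle a b i j m) :=
  (isOpen_Ioo.preimage (continuous_coordFst a b)).inter
    ((isOpen_Ioo.preimage (continuous_coordSnd a b)).inter
      (isOpen_Ioo.preimage ((continuous_coordFst a b).sub (continuous_coordSnd a b))))

theorem convex_gridTriangle (a b : Plane) (i j m : ℤ) : Convex ℝ (gridTriangle a b i j m) :=
  ((convex_Ioo _ _).linear_preimage (coordFst a b)).inter
    (((convex_Ioo _ _).linear_preimage (coordSnd a b)).inter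
      ((convex_Ioo _ _).linear_preimage (coordFst a b - coordSnd a b)))

theorem isBounded_gridTriangle {a b : Plane} (h : planeDet a b ≠ 0) (i j m : ℤ) :
    Bornology.IsBounded (gridTriangle a b i j m) := by
  have hK : IsCompact ((fun p : ℝ × ℝ => p.1 • a + p.2 • b) ''
      (Set.Icc (i : ℝ) (i + 1) ×ˢ Set.Icc (j : ℝ) (j + 1))) :=
    (isCompact_Icc.prod isCompact_Icc).image (by fun_prop)
  refine hK.isBounded.subset fun x hx => ⟨(coordFst a b x, coordSnd a b x), ?_, ?_⟩
  · exact ⟨Set.Ioo_subset_Icc_self hx.1, Set.Ioo_subset_Icc_self hx.2.1⟩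
  · exact coord_smul_add_smul h x

theorem gridTriangle_eq_of_mem {a b x : Plane} {i j m i' j' m' : ℤ}
    (hx : x ∈ gridTriangle a b i j m) (hx' : x ∈ gridTriangle a b i' j' m') :
    i = i' ∧ j = j' ∧ m = m' := by
  have key : ∀ {r : ℝ} {n n' : ℤ}, r ∈ Set.Ioo (n : ℝ) (n + 1) → r ∈ Set.Ioo (n' : ℝ) (n' + 1) →
      n = n' := by
    rintro r n n' ⟨h1, h2⟩ ⟨h3, h4⟩
    have h5 : (n : ℝ) < n' + 1 := by linarith
    have h6 : (n' : ℝ) < n + 1 := by linarith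
    norm_cast at h5 h6
    omega
  exact ⟨key hx.1 hx'.1, key hx.2.1 hx'.2.1, key hx.2.2 hx'.2.2⟩

theorem coord_ext {a b x y : Plane} (h : planeDet a b ≠ 0) (h0 : coordFst a b x = coordFst a b y)
    (h1 : coordSnd a b x = coordSnd a b y) : x = y := by
  rw [← coord_smul_add_smul h x, h0, h1, coord_smul_add_smul h]

theorem exists_mem_gridTriangle {a b x : Plane} (h0 : ∀ n : ℤ, coordFst a b x ≠ n)
    (h1 : ∀ n : ℤ, coordSnd a b x ≠ n) (h2 : ∀ n : ℤ, coordFst a b x - coordSnd a b x ≠ n) :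
    ∃ i j m : ℤ, x ∈ gridTriangle a b i j m := by
  have key : ∀ {r : ℝ}, (∀ n : ℤ, r ≠ n) → ∃ n : ℤ, r ∈ Set.Ioo (n : ℝ) (n + 1) := fun {r} hr =>
    ⟨⌊r⌋, (Int.floor_le r).lt_of_ne (hr _).symm, Int.lt_floor_add_one r⟩
  obtain ⟨i, hi⟩ := key h0
  obtain ⟨j, hj⟩ := key h1
  obtain ⟨m, hm⟩ := key h2
  exact ⟨i, j, m, hi, hj, hm⟩

theorem ne_intCast_of_mem_Ioo {r : ℝ} {n : ℤ} (h : r ∈ Set.Ioo (n : ℝ) (n + 1)) (n' : ℤ) :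
    r ≠ n' := by
  rintro rfl
  obtain ⟨h1, h2⟩ := h
  norm_cast at h1 h2
  omega

theorem nonempty_homeomorph_ball {s : Set Plane} (hc : Convex ℝ s) (ho : IsOpen s)
    (hb : Bornology.IsBounded s) (hne : s.Nonempty) :
    Nonempty (s ≃ₜ Metric.ball (0 : Plane) 1) := by
  obtain ⟨e, he, -, -⟩ := exists_homeomorph_image_interior_closure_frontier_eq_unitBall hc
    (by rwa [ho.interior_eq]) hb
  rw [ho.interior_eq] at he
  exact ⟨(e.image s).trans (Homeomorph.setCongr he)⟩

/-- The piece and the union of the pieces different from it are disjoint open sets covering `S`.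
Pieces with distinct indices may coincide, as the images on the torus of translated triangles do. -/
theorem connectedComponentIn_eq_of_iUnion {X ι : Type*} [TopologicalSpace X] {U : ι → Set X}
    {S : Set X} (hS : S = ⋃ i, U i) (ho : ∀ i, IsOpen (U i)) (hc : ∀ i, IsPreconnected (U i))
    (hd : ∀ i j, (U i ∩ U j).Nonempty → U i = U j) {x : X} {i : ι} (hx : x ∈ U i) :
    connectedComponentIn S x = U i := by
  have hxS : x ∈ S := hS ▸ Set.mem_iUnion_of_mem i hx
  refine Set.Subset.antisymm ?_
    ((hc i).subset_connectedComponentIn hx (hS ▸ Set.subset_iUnion U i))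
  refine isPreconnected_connectedComponentIn.subset_left_of_subset_union (ho i)
    (v := ⋃ j ∈ {j | U j ≠ U i}, U j) (isOpen_biUnion fun j _ => ho j) ?_ ?_
    ⟨x, mem_connectedComponentIn hxS, hx⟩
  · rw [Set.disjoint_iUnion₂_right]
    intro j hj
    rw [Set.disjoint_iff_inter_eq_empty]
    by_contra hne
    exact hj (hd i j (Set.nonempty_iff_ne_empty.mpr hne)).symm
  · intro y hy
    obtain ⟨j, hj⟩ := Set.mem_iUnion.mp (hS ▸ connectedComponentIn_subset S x hy)
    by_cases hji : U j = U i
    · exact Or.inl (hji ▸ hj)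
    · exact Or.inr (Set.mem_biUnion hji hj)

/-! ### Lattices -/

theorem mem_lattice_iff {M : Matrix (Fin 2) (Fin 2) ℝ} {x : Plane} :
    x ∈ lattice M ↔ ∃ m n : ℤ,
      x = (m : ℝ) • (!₂[M 0 0, M 1 0] : Plane) + (n : ℝ) • (!₂[M 0 1, M 1 1] : Plane) := by
  have : (Set.range fun j : Fin 2 => (!₂[M 0 j, M 1 j] : Plane)) =
      {!₂[M 0 0, M 1 0], !₂[M 0 1, M 1 1]} := by
    ext y
    simp [eq_comm]
  rw [lattice, this, AddSubgroup.mem_closure_pair]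
  simp only [Int.cast_smul_eq_zsmul, eq_comm]

theorem toTorus_eq_iff {M : Matrix (Fin 2) (Fin 2) ℝ} {x y : Plane} :
    toTorus M x = toTorus M y ↔ y - x ∈ lattice M := by
  rw [toTorus, toTorus, QuotientAddGroup.eq, neg_add_eq_sub]

theorem toTorus_add (M : Matrix (Fin 2) (Fin 2) ℝ) (x y : Plane) :
    toTorus M (x + y) = toTorus M x + toTorus M y := rfl

theorem continuous_toTorus (M : Matrix (Fin 2) (Fin 2) ℝ) : Continuous (toTorus M) :=
  continuous_quotient_mk'

theorem isOpenMap_toTorus (M : Matrix (Fin 2) (Fin 2) ℝ) : IsOpenMap (toTorus M) :=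
  QuotientAddGroup.isOpenMap_coe

theorem toTorus_surjective (M : Matrix (Fin 2) (Fin 2) ℝ) : Function.Surjective (toTorus M) :=
  QuotientAddGroup.mk_surjective

/-! ### Triangular grids on a flat torus -/

/-- A linear map that takes the integer lattice onto the lattice of `M`, such that the images of the
first two edge vectors of the one-vertex triangulation are positively oriented and form an acute
angle. -/
structure GridFrame (M : Matrix (Fin 2) (Fin 2) ℝ) where
  toLin : Plane →ₗ[ℝ] Plane
  mem_lattice : ∀ x, x ∈ lattice M ↔ ∃ y ∈ lattice 1, toLin y = x
  det_pos : 0 < planeDet (toLin (edgeVector 0)) (toLin (edgeVector 1))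
  inner_pos : 0 < inner ℝ (toLin (edgeVector 0)) (toLin (edgeVector 1))

/-- The image of the `k × k` cover of the one-vertex triangulation under a linear map. -/
def gridTriangulation {M : Matrix (Fin 2) (Fin 2) ℝ} (B : GridFrame M) (k : ℕ) [NeZero k] :
    GeodesicGraph M where
  V := ZMod k × ZMod k
  E := (ZMod k × ZMod k) × Fin 3
  fintypeV := inferInstance
  fintypeE := inferInstance
  src e := e.1
  tgt e := e.1 + edgeStep k e.2
  pos v := toTorus M (B.toLin !₂[(v.1.val : ℝ) / k, (v.2.val : ℝ) / k])
  disp e := B.toLin ((1 / (k : ℝ)) • edgeVector e.2)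
  pos_tgt e := by
    have h := gridPoint_add_step k e.1 e.2
    rw [gridPoint, gridPoint, ← toTorus_add, toTorus_eq_iff] at h
    rw [← toTorus_add, ← map_add, toTorus_eq_iff, ← map_sub]
    exact (B.mem_lattice _).mpr ⟨_, h, rfl⟩

namespace GridFrame

variable {M : Matrix (Fin 2) (Fin 2) ℝ} (B : GridFrame M) (k : ℕ)

/-- The displacement vector of the first edges of the triangular grid. -/
def fst : Plane := B.toLin ((1 / (k : ℝ)) • edgeVector 0)

/-- The displacement vector of the second edges of the triangular grid. -/
def snd : Plane := B.toLin ((1 / (k : ℝ)) • edgeVector 1)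

theorem toLin_edgeVector_two : B.toLin ((1 / (k : ℝ)) • edgeVector 2) = B.fst k + B.snd k := by
  rw [fst, snd, ← map_add, ← smul_add]
  congr 2
  ext i
  fin_cases i <;> simp [edgeVector]
  norm_num

theorem toLin_eq [NeZero k] (s t : ℝ) :
    B.toLin !₂[s / k, t / k] = (s - t) • B.fst k + t • B.snd k := by
  rw [fst, snd, ← map_smul, ← map_smul, ← map_add]
  congr 1
  ext i
  fin_cases i <;> simp [edgeVector] <;> ring

theorem det_fst_snd_pos [NeZero k] : 0 < planeDet (B.fst k) (B.snd k) := by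
  have hk : (0 : ℝ) < k := Nat.cast_pos.mpr (NeZero.pos k)
  rw [fst, snd, map_smul, map_smul, planeDet_smul_left, planeDet_smul_right]
  have := B.det_pos
  positivity

theorem inner_fst_snd_pos [NeZero k] : 0 < inner ℝ (B.fst k) (B.snd k) := by
  have hk : (0 : ℝ) < k := Nat.cast_pos.mpr (NeZero.pos k)
  rw [fst, snd, map_smul, map_smul, real_inner_smul_left, real_inner_smul_right]
  have := B.inner_pos
  positivity

/-- The first coordinate with respect to the grid. -/
abbrev x : Plane →ₗ[ℝ] ℝ := coordFst (B.fst k) (B.snd k)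

/-- The second coordinate with respect to the grid. -/
abbrev y : Plane →ₗ[ℝ] ℝ := coordSnd (B.fst k) (B.snd k)

theorem x_fst [NeZero k] : B.x k (B.fst k) = 1 := coordFst_left (B.det_fst_snd_pos k).ne'

theorem y_fst : B.y k (B.fst k) = 0 := coordSnd_left _ _

theorem x_snd : B.x k (B.snd k) = 0 := coordFst_right _ _

theorem y_snd [NeZero k] : B.y k (B.snd k) = 1 := coordSnd_right (B.det_fst_snd_pos k).ne'

theorem x_combination [NeZero k] (s t : ℝ) : B.x k (s • B.fst k + t • B.snd k) = s := by
  rw [map_add, map_smul, map_smul, x_fst, x_snd]; simp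

theorem y_combination [NeZero k] (s t : ℝ) : B.y k (s • B.fst k + t • B.snd k) = t := by
  rw [map_add, map_smul, map_smul, y_fst, y_snd]; simp

theorem combination_eq [NeZero k] (p : Plane) : B.x k p • B.fst k + B.y k p • B.snd k = p :=
  coord_smul_add_smul (B.det_fst_snd_pos k).ne' p

/-- Since `(1, 0)`, `(1, 1)` is a basis of the integer lattice, the `k`-fold grid vectors are a
basis of `lattice M`. Equality on the torus thus becomes congruence of grid coordinates modulo `k`.
-/
theorem mem_lattice_iff_coord [NeZero k] (p : Plane) :
    p ∈ lattice M ↔ ∃ m n : ℤ, B.x k p = k * m ∧ B.y k p = k * n := by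
  have hk : (k : ℝ) ≠ 0 := Nat.cast_ne_zero.mpr (NeZero.ne k)
  have key : ∀ s t : ℝ, B.toLin !₂[s, t] =
      ((k : ℝ) * s - k * t) • B.fst k + ((k : ℝ) * t) • B.snd k := fun s t => by
    rw [← B.toLin_eq k, mul_div_cancel_left₀ _ hk, mul_div_cancel_left₀ _ hk]
  have h1 : ∀ m n : ℤ, (m : ℝ) • (!₂[(1 : Matrix (Fin 2) (Fin 2) ℝ) 0 0,
      (1 : Matrix (Fin 2) (Fin 2) ℝ) 1 0] : Plane) +
        (n : ℝ) • (!₂[(1 : Matrix (Fin 2) (Fin 2) ℝ) 0 1,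
          (1 : Matrix (Fin 2) (Fin 2) ℝ) 1 1] : Plane) = !₂[(m : ℝ), (n : ℝ)] := fun m n => by
    ext i
    fin_cases i <;> simp
  rw [B.mem_lattice]
  constructor
  · rintro ⟨q, hq, rfl⟩
    obtain ⟨m, n, rfl⟩ := mem_lattice_iff.mp hq
    refine ⟨m - n, n, ?_, ?_⟩
    · rw [h1, key, x_combination]; push_cast; ring
    · rw [h1, key, y_combination]
  · rintro ⟨m, n, hx, hy⟩
    refine ⟨_, mem_lattice_iff.mpr ⟨m + n, n, rfl⟩, ?_⟩
    rw [h1, key, ← B.combination_eq k p, hx, hy]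
    congr 2
    push_cast; ring

theorem toTorus_eq_iff_coord [NeZero k] {p q : Plane} :
    toTorus M p = toTorus M q ↔
      ∃ m n : ℤ, B.x k q = B.x k p + k * m ∧ B.y k q = B.y k p + k * n := by
  rw [toTorus_eq_iff, B.mem_lattice_iff_coord k]
  simp only [map_sub, sub_eq_iff_eq_add']

theorem disp_zero [NeZero k] (v : ZMod k × ZMod k) :
    (gridTriangulation B k).disp (v, 0) = B.fst k := rfl

theorem disp_one [NeZero k] (v : ZMod k × ZMod k) :
    (gridTriangulation B k).disp (v, 1) = B.snd k := rfl

theorem disp_two [NeZero k] (v : ZMod k × ZMod k) :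
    (gridTriangulation B k).disp (v, 2) = B.fst k + B.snd k := B.toLin_edgeVector_two k

theorem pos_eq [NeZero k] (v : ZMod k × ZMod k) : (gridTriangulation B k).pos v =
    toTorus M (((v.1.val : ℝ) - v.2.val) • B.fst k + (v.2.val : ℝ) • B.snd k) := by
  rw [← B.toLin_eq k]; rfl

/-- The index is `(m + n, n)` because `m (1, 0) + n (1, 1) = (m + n, n)`. Arbitrary integers replace
the representatives `ZMod.val` from here on. -/
theorem pos_intCast [NeZero k] (m n : ℤ) :
    (gridTriangulation B k).pos (((m + n : ℤ) : ZMod k), (n : ZMod k)) =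
      toTorus M ((m : ℝ) • B.fst k + (n : ℝ) • B.snd k) := by
  rw [pos_eq, B.toTorus_eq_iff_coord k]
  simp only [x_combination, y_combination]
  have key : ∀ z : ℤ, (z : ℝ) = ((z : ZMod k).val : ℝ) + k * ((z / (k : ℤ) : ℤ) : ℝ) := fun z => by
    have h := Int.emod_add_mul_ediv z k
    rw [← ZMod.val_intCast] at h
    exact_mod_cast h.symm
  refine ⟨(m + n) / (k : ℤ) - n / (k : ℤ), n / (k : ℤ), ?_, key n⟩
  have h1 := key (m + n)
  have h2 := key n
  push_cast at h1 h2 ⊢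
  linear_combination h1 - h2

theorem exists_int_pos [NeZero k] (v : ZMod k × ZMod k) :
    ∃ m n : ℤ, v = (((m + n : ℤ) : ZMod k), (n : ZMod k)) := by
  refine ⟨v.1.val - v.2.val, v.2.val, ?_⟩
  ext <;> simp

theorem pos_injective [NeZero k] : Function.Injective (gridTriangulation B k).pos := by
  intro v w h
  obtain ⟨m, n, rfl⟩ := exists_int_pos k v
  obtain ⟨m', n', rfl⟩ := exists_int_pos k w
  rw [pos_intCast, pos_intCast, B.toTorus_eq_iff_coord k] at h
  simp only [x_combination, y_combination] at h
  obtain ⟨r, s, h1, h2⟩ := h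
  have h1' : m' = m + k * r := by exact_mod_cast h1
  have h2' : n' = n + k * s := by exact_mod_cast h2
  subst h1' h2'
  exact Prod.ext (by simp) (by simp)

theorem edgePoint_intCast [NeZero k] (m n : ℤ) (c : Fin 3) (t : ℝ) :
    (gridTriangulation B k).edgePoint ((((m + n : ℤ) : ZMod k), (n : ZMod k)), c) t =
      -- The two tables list the grid coordinates of the three edge vectors.
      toTorus M ((m + t * (![1, 0, 1] : Fin 3 → ℝ) c) • B.fst k +
        (n + t * (![0, 1, 1] : Fin 3 → ℝ) c) • B.snd k) := by
  refine (congrArg (· + toTorus M (t • (gridTriangulation B k).disp _))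
    (B.pos_intCast k m n)).trans ?_
  rw [← toTorus_add]
  congr 1
  fin_cases c
  · change _ + t • (gridTriangulation B k).disp (_, 0) = _
    rw [disp_zero]
    simp
    module
  · change _ + t • (gridTriangulation B k).disp (_, 1) = _
    rw [disp_one]
    simp
    module
  · change _ + t • (gridTriangulation B k).disp (_, 2) = _
    rw [disp_two]
    simp
    module

/-- Integrality of the grid coordinates is preserved by lattice translations and tells the cases
apart: both are integers at a vertex, only `y` inside a first edge, only `x` inside a second edge,
neither inside a diagonal. -/
theorem isEmbedding [NeZero k] : (gridTriangulation B k).IsEmbedding := by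
  have hn : ∀ {t : ℝ}, t ∈ Set.Ioo (0 : ℝ) 1 → ∀ z : ℤ, t ≠ z := fun {t} ht z =>
    ne_intCast_of_mem_Ioo (n := 0) (by simpa using ht) z
  refine ⟨B.pos_injective k, ?_, ?_⟩
  · rintro ⟨v, c⟩ ⟨w, c'⟩ t ht t' ht' h
    obtain ⟨m, n, rfl⟩ := exists_int_pos k v
    obtain ⟨m', n', rfl⟩ := exists_int_pos k w
    have h0 := h
    rw [edgePoint_intCast, edgePoint_intCast, B.toTorus_eq_iff_coord k] at h
    simp only [x_combination, y_combination] at h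
    obtain ⟨r, s, h1, h2⟩ := h
    -- Parameters in the open unit interval that differ by an integer are equal.
    have heq : ∀ z : ℤ, t' - t = z → t' = t := fun z hz => by
      have h3 : (z : ℝ) < 1 := by linarith [ht.1, ht'.2]
      have h4 : (-1 : ℝ) < z := by linarith [ht.2, ht'.1]
      have h5 : z = 0 := by
        have h3' : z < 1 := by exact_mod_cast h3
        have h4' : -1 < z := by exact_mod_cast h4
        omega
      rw [h5] at hz
      simpa [sub_eq_zero] using hz
    have hc : c = c' ∧ t' = t := by
      fin_cases c <;> fin_cases c' <;> simp at h1 h2 ⊢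
      · exact heq (m + k * r - m') (by push_cast; linear_combination h1)
      · exact hn ht' (n + k * s - n') (by push_cast; linear_combination h2)
      · exact hn ht' (n + k * s - n') (by push_cast; linear_combination h2)
      · exact hn ht' (m + k * r - m') (by push_cast; linear_combination h1)
      · exact heq (n + k * s - n') (by push_cast; linear_combination h2)
      · exact hn ht' (m + k * r - m') (by push_cast; linear_combination h1)
      · exact hn ht (n' - k * s - n) (by push_cast; linear_combination -h2)
      · exact hn ht (m' - k * r - m) (by push_cast; linear_combination -h1)
      · exact heq (n + k * s - n') (by push_cast; linear_combination h2)
    obtain ⟨rfl, rfl⟩ := hc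
    refine ⟨?_, rfl⟩
    have h1' : m' = m + k * r := by
      have : (m' : ℝ) = m + k * r := by linear_combination h1
      exact_mod_cast this
    have h2' : n' = n + k * s := by
      have : (n' : ℝ) = n + k * s := by linear_combination h2
      exact_mod_cast this
    subst h1' h2'
    exact Prod.ext (Prod.ext (by simp) (by simp)) rfl
  · rintro ⟨v, c⟩ w t ht h
    obtain ⟨m, n, rfl⟩ := exists_int_pos k v
    obtain ⟨m', n', rfl⟩ := exists_int_pos k w
    rw [edgePoint_intCast, pos_intCast, B.toTorus_eq_iff_coord k] at h
    simp only [x_combination, y_combination] at h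
    obtain ⟨r, s, h1, h2⟩ := h
    fin_cases c <;> simp at h1 h2
    · exact hn ht (m' - k * r - m) (by push_cast; linear_combination -h1)
    · exact hn ht (n' - k * s - n) (by push_cast; linear_combination -h2)
    · exact hn ht (n' - k * s - n) (by push_cast; linear_combination -h2)

/-! ### Faces -/

theorem mem_coverImage_iff [NeZero k] (p : Plane) :
    p ∈ (gridTriangulation B k).coverImage ↔
      (∃ n : ℤ, B.x k p = n) ∨ (∃ n : ℤ, B.y k p = n) ∨ ∃ n : ℤ, B.x k p - B.y k p = n := by
  constructor
  · rintro (⟨v, hv⟩ | ⟨⟨v, c⟩, t, -, ht⟩)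
    · obtain ⟨m, n, rfl⟩ := exists_int_pos k v
      rw [pos_intCast, B.toTorus_eq_iff_coord k] at hv
      simp only [x_combination, y_combination] at hv
      obtain ⟨r, s, h1, h2⟩ := hv
      exact Or.inl ⟨m + k * r, by rw [h1]; push_cast; ring⟩
    · obtain ⟨m, n, rfl⟩ := exists_int_pos k v
      rw [edgePoint_intCast, eq_comm, B.toTorus_eq_iff_coord k] at ht
      simp only [x_combination, y_combination] at ht
      obtain ⟨r, s, h1, h2⟩ := ht
      fin_cases c <;> simp at h1 h2
      · exact Or.inr (Or.inl ⟨n + k * s, by rw [h2]; push_cast; ring⟩)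
      · exact Or.inl ⟨m + k * r, by rw [h1]; push_cast; ring⟩
      · exact Or.inr (Or.inr ⟨m + k * r - n - k * s, by rw [h1, h2]; push_cast; ring⟩)
  -- On each grid line, the integer part of a coordinate gives the source of the edge and its
  -- fractional part the parameter.
  · have key : ∀ (m n : ℤ) (c : Fin 3) (t : ℝ), t ∈ Set.Icc (0 : ℝ) 1 →
        B.x k p = m + t * (![1, 0, 1] : Fin 3 → ℝ) c →
        B.y k p = n + t * (![0, 1, 1] : Fin 3 → ℝ) c →
          p ∈ (gridTriangulation B k).coverImage := fun m n c t ht h1 h2 => by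
      refine Or.inr ⟨((((m + n : ℤ) : ZMod k), (n : ZMod k)), c), t, ht, ?_⟩
      rw [edgePoint_intCast, ← h1, ← h2, combination_eq]
    have hf : ∀ r : ℝ, Int.fract r ∈ Set.Icc (0 : ℝ) 1 := fun r =>
      ⟨Int.fract_nonneg r, (Int.fract_lt_one r).le⟩
    rintro (⟨n, hn⟩ | ⟨n, hn⟩ | ⟨n, hn⟩)
    · exact key n ⌊B.y k p⌋ 1 _ (hf (B.y k p)) (by simp [hn]) (by simp)
    · exact key ⌊B.x k p⌋ n 0 _ (hf (B.x k p)) (by simp) (by simp [hn])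
    · refine key (⌊B.y k p⌋ + n) ⌊B.y k p⌋ 2 _ (hf (B.y k p)) ?_ (by simp)
      have := Int.floor_add_fract (B.y k p)
      change _ = _ + _ * (1 : ℝ)
      push_cast
      linear_combination hn - this

/-- The faces of the universal cover of the triangular grid. -/
abbrev tri (i j m : ℤ) : Set Plane := gridTriangle (B.fst k) (B.snd k) i j m

theorem compl_coverImage_eq [NeZero k] : (gridTriangulation B k).coverImageᶜ =
    ⋃ i : ℤ × ℤ × ℤ, B.tri k i.1 i.2.1 i.2.2 := by
  ext p
  rw [Set.mem_compl_iff, mem_coverImage_iff, Set.mem_iUnion]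
  constructor
  · intro h
    push Not at h
    obtain ⟨i, j, m, hm⟩ := exists_mem_gridTriangle h.1 h.2.1 h.2.2
    exact ⟨(i, j, m), hm⟩
  · rintro ⟨i, h1, h2, h3⟩ (⟨n, hn⟩ | ⟨n, hn⟩ | ⟨n, hn⟩)
    · exact ne_intCast_of_mem_Ioo h1 n hn
    · exact ne_intCast_of_mem_Ioo h2 n hn
    · exact ne_intCast_of_mem_Ioo h3 n hn

theorem compl_image_eq [NeZero k] : (gridTriangulation B k).imageᶜ =
    ⋃ i : ℤ × ℤ × ℤ, toTorus M '' B.tri k i.1 i.2.1 i.2.2 := by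
  rw [← Set.image_iUnion, ← compl_coverImage_eq, GeodesicGraph.coverImage, ← Set.preimage_compl,
    Set.image_preimage_eq _ (toTorus_surjective M)]

theorem coverComponent_eq [NeZero k] {i j m : ℤ} {p : Plane} (hp : p ∈ B.tri k i j m) :
    connectedComponentIn (gridTriangulation B k).coverImageᶜ p = B.tri k i j m := by
  refine connectedComponentIn_eq_of_iUnion (i := (i, j, m)) (B.compl_coverImage_eq k)
    (fun _ => isOpen_gridTriangle _ _ _ _ _) (fun _ => (convex_gridTriangle _ _ _ _ _).isPreconnected)
    ?_ hp
  rintro ⟨i, j, m⟩ ⟨i', j', m'⟩ ⟨q, hq, hq'⟩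
  obtain ⟨rfl, rfl, rfl⟩ := gridTriangle_eq_of_mem hq hq'
  rfl

theorem tri_translate [NeZero k] {l : Plane} {r s : ℤ} (hx : B.x k l = r) (hy : B.y k l = s)
    (i j m : ℤ) :
    (fun p => p + l) '' B.tri k i j m = B.tri k (i + r) (j + s) (m + (r - s)) := by
  rw [Set.image_add_right]
  ext p
  simp only [gridTriangle, Set.mem_preimage, Set.mem_ofPred_eq, map_add, map_neg,
    LinearMap.sub_apply, Set.mem_Ioo, Int.cast_add, Int.cast_sub]
  simp only [x, y] at hx hy
  rw [hx, hy]
  constructor <;> rintro ⟨⟨h1, h2⟩, ⟨h3, h4⟩, h5, h6⟩ <;>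
    exact ⟨⟨by linarith, by linarith⟩, ⟨by linarith, by linarith⟩, by linarith, by linarith⟩

theorem component_eq [NeZero k] {i j m : ℤ} {p : Plane} (hp : p ∈ B.tri k i j m) :
    connectedComponentIn (gridTriangulation B k).imageᶜ (toTorus M p) =
      toTorus M '' B.tri k i j m := by
  refine connectedComponentIn_eq_of_iUnion (i := (i, j, m)) (B.compl_image_eq k)
    (fun _ => isOpenMap_toTorus M _ (isOpen_gridTriangle _ _ _ _ _))
    (fun _ => (convex_gridTriangle _ _ _ _ _).isPreconnected.image _
      (continuous_toTorus M).continuousOn)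
    ?_ (Set.mem_image_of_mem _ hp)
  rintro ⟨i, j, m⟩ ⟨i', j', m'⟩ ⟨_, ⟨q, hq, rfl⟩, q', hq', he⟩
  -- If the images of two triangles meet, the lattice translation between the two preimages takes
  -- one triangle onto the other, so the images agree.
  have hl := toTorus_eq_iff.mp he.symm
  obtain ⟨r, s, hr, hs⟩ := (B.mem_lattice_iff_coord k _).mp hl
  have ht := B.tri_translate k (l := q' - q) (r := k * r) (s := k * s) (by rw [hr]; push_cast; rfl)
    (by rw [hs]; push_cast; rfl) i j m
  have hq2 : q' ∈ (fun p => p + (q' - q)) '' B.tri k i j m := ⟨q, hq, by simp⟩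
  have h3 : (fun p => p + (q' - q)) '' B.tri k i j m = B.tri k i' j' m' := by
    rw [ht] at hq2 ⊢
    obtain ⟨h1, h2, h3⟩ := gridTriangle_eq_of_mem hq2 hq'
    rw [h1, h2, h3]
  change toTorus M '' B.tri k i j m = toTorus M '' B.tri k i' j' m'
  rw [← h3, Set.image_image]
  refine Set.image_congr fun z _ => ?_
  rw [toTorus_eq_iff]
  simpa using hl

/-- Coordinates of two points of a triangle differ by less than `1`, those of lattice-equivalent
points by multiples of `k ≥ 1`. -/
theorem injOn_toTorus_tri [NeZero k] (i j m : ℤ) : Set.InjOn (toTorus M) (B.tri k i j m) := by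
  have hk : (1 : ℤ) ≤ k := by exact_mod_cast NeZero.one_le
  have key : ∀ {s t : ℝ} {n r : ℤ}, s ∈ Set.Ioo (n : ℝ) (n + 1) → t ∈ Set.Ioo (n : ℝ) (n + 1) →
      t = s + k * r → s = t := by
    rintro s t n r ⟨h1, h2⟩ ⟨h3, h4⟩ he
    have h5 : ((k * r : ℤ) : ℝ) < 1 := by push_cast; linarith
    have h6 : (-1 : ℝ) < ((k * r : ℤ) : ℝ) := by push_cast; linarith
    have h7 : (k : ℤ) * r = 0 := by
      have h5' : k * r < 1 := by exact_mod_cast h5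
      have h6' : -1 < k * r := by exact_mod_cast h6
      omega
    have h8 : (k : ℝ) * r = 0 := by exact_mod_cast h7
    linarith
  intro p hp q hq h
  obtain ⟨r, s, h1, h2⟩ := (B.toTorus_eq_iff_coord k).mp h
  exact coord_ext (B.det_fst_snd_pos k).ne' (key hp.1 hq.1 h1) (key hp.2.1 hq.2.1 h2)

/-- A face is the homeomorphic image of a triangle of the plane, and a bounded open convex set is a
disk. -/
theorem isCellular [NeZero k] : (gridTriangulation B k).IsCellular := by
  rintro ⟨_, x, hx, rfl⟩
  rw [B.compl_image_eq k] at hx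
  obtain ⟨⟨i, j, m⟩, p, hp, rfl⟩ := Set.mem_iUnion.mp hx
  have ho := isOpen_gridTriangle (B.fst k) (B.snd k) i j m
  have hemb : Topology.IsOpenEmbedding ((B.tri k i j m).domRestrict (toTorus M)) :=
    .of_continuous_injective_isOpenMap ((continuous_toTorus M).comp continuous_subtype_val)
      (B.injOn_toTorus_tri k i j m).injective ((isOpenMap_toTorus M).domRestrict ho)
  obtain ⟨e⟩ := nonempty_homeomorph_ball (convex_gridTriangle _ _ _ _ _) ho
    (isBounded_gridTriangle (B.det_fst_snd_pos k).ne' i j m) ⟨p, hp⟩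
  have hs : Set.range ((B.tri k i j m).domRestrict (toTorus M)) =
      connectedComponentIn (gridTriangulation B k).imageᶜ (toTorus M p) := by
    rw [Set.range_domRestrict, B.component_eq k hp]
  exact ⟨((hemb.isEmbedding.toHomeomorph.trans (Homeomorph.setCongr hs)).symm).trans e⟩

end GridFrame

/-! ### Leaving an edge along its normal, and turning around a dual vertex -/

theorem inner_rot90_left (u v : Plane) : inner ℝ (rot90 u) v = planeDet u v := by
  rw [plane_inner_eq]
  simp [rot90, planeDet]; ring

/-- For leaving the midpoint of an edge into an adjacent triangle: each defining coordinate is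
either strictly inside its interval, or at an end and moving inwards. -/
theorem eventually_add_mul_mem_Ioo {s t l : ℝ}
    (h : (l < s ∧ s < l + 1) ∨ (s = l ∧ 0 < t) ∨ (s = l + 1 ∧ t < 0)) :
    ∀ᶠ ε : ℝ in 𝓝[>] 0, s + ε * t ∈ Set.Ioo l (l + 1) := by
  have hc : Tendsto (fun ε : ℝ => s + ε * t) (𝓝[>] 0) (𝓝 s) := by
    have : Continuous fun ε : ℝ => s + ε * t := by fun_prop
    simpa using (this.tendsto 0).mono_left nhdsWithin_le_nhds
  rcases h with ⟨h1, h2⟩ | ⟨rfl, ht⟩ | ⟨rfl, ht⟩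
  · exact hc.eventually (Ioo_mem_nhds h1 h2)
  · filter_upwards [hc.eventually (Iio_mem_nhds (lt_add_one s)), self_mem_nhdsWithin] with ε h1 h2
    have := mul_pos h2 ht
    exact ⟨by linarith, h1⟩
  · filter_upwards [hc.eventually (Ioi_mem_nhds (lt_add_one l)), self_mem_nhdsWithin] with ε h1 h2
    have := mul_neg_of_pos_of_neg h2 ht
    exact ⟨h1, by linarith⟩

namespace GeodesicGraph

variable {M : Matrix (Fin 2) (Fin 2) ℝ}

/-- If two of three consecutive darts around a vertex are less than half a turn apart clockwise,
then the remaining turns are at most half a turn. -/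
theorem CcwNext.planeDet_nonneg {H : GeodesicGraph M} {h1 h2 h3 : H.Dart} (h23 : H.CcwNext h2 h3)
    (h31 : H.CcwNext h3 h1) (h : planeDet (H.dartDisp h2) (H.dartDisp h3) < 0) :
    0 ≤ planeDet (H.dartDisp h1) (H.dartDisp h2) ∧
      0 ≤ planeDet (H.dartDisp h3) (H.dartDisp h1) := by
  have t23 : H.tail h2 = H.tail h3 := by
    obtain ⟨_, _, _, ⟨ht, _⟩, _⟩ := h23
    exact ht
  have t31 : H.tail h3 = H.tail h1 := by
    obtain ⟨_, _, _, ⟨ht, _⟩, _⟩ := h31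
    exact ht
  constructor
  · rw [planeDet_swap]
    linarith [h23.planeDet_nonpos h (t23.trans t31)]
  · by_contra! hneg
    have := h31.planeDet_nonpos hneg t23.symm
    rw [planeDet_swap] at this
    linarith

theorem dartDisp_true (G : GeodesicGraph M) (e : G.E) : G.dartDisp (e, true) = G.disp e := rfl

theorem dartDisp_false (G : GeodesicGraph M) (e : G.E) : G.dartDisp (e, false) = -G.disp e := rfl

/-- In a triangle of darts dual to a triangle with edge vectors `a`, `b`, `a + b`, the dual edges
are rotated in the same sense. -/
theorem mul_pos_of_ccwNext {H : GeodesicGraph M} {a b : Plane} (hab : 0 < planeDet a b)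
    {ea eb ec : H.E} {r s t : ℝ} (hr : r ≠ 0) (hs : s ≠ 0) (ht : t ≠ 0)
    (ha : H.disp ea = r • rot90 a) (hb : H.disp eb = s • rot90 b)
    (hc : H.disp ec = t • rot90 (a + b)) (o : Bool)
    (h1 : H.CcwNext (eb, o) (ec, !o)) (h2 : H.CcwNext (ec, !o) (ea, o)) : 0 < s * t := by
  by_contra! hle
  have hst : s * t < 0 := lt_of_le_of_ne hle (mul_ne_zero hs ht)
  have key := h1.planeDet_nonneg h2
  have e23 : planeDet (H.dartDisp (eb, o)) (H.dartDisp (ec, !o)) = s * t * planeDet a b := by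
    cases o <;> simp only [Bool.not_true, Bool.not_false, dartDisp_true, dartDisp_false, hb, hc,
      planeDet_neg_left, planeDet_neg_right, planeDet_smul_left, planeDet_smul_right,
      planeDet_rot90_rot90, planeDet_add_right, planeDet_self, planeDet_swap b a] <;> ring
  have e12 : planeDet (H.dartDisp (ea, o)) (H.dartDisp (eb, o)) = r * s * planeDet a b := by
    cases o <;> simp only [dartDisp_true, dartDisp_false, ha, hb,
      planeDet_neg_left, planeDet_neg_right, planeDet_smul_left, planeDet_smul_right,
      planeDet_rot90_rot90] <;> ring
  have e31 : planeDet (H.dartDisp (ec, !o)) (H.dartDisp (ea, o)) = t * r * planeDet a b := by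
    cases o <;> simp only [Bool.not_true, Bool.not_false, dartDisp_true, dartDisp_false, ha, hc,
      planeDet_neg_left, planeDet_neg_right, planeDet_smul_left, planeDet_smul_right,
      planeDet_rot90_rot90, planeDet_add_left, planeDet_self, planeDet_swap b a] <;> ring
  rw [e23, e12, e31] at key
  -- Were `s` and `t` of opposite signs, this turn would exceed half a turn, forcing `r * s ≥ 0` and
  -- `t * r ≥ 0`; their product `r ^ 2 * (s * t)` is negative.
  obtain ⟨k1, k2⟩ := key (mul_neg_of_neg_of_pos hst hab)
  have k1' := nonneg_of_mul_nonneg_left k1 hab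
  have k2' := nonneg_of_mul_nonneg_left k2 hab
  have h4 := mul_nonneg k1' k2'
  have h5 : 0 < r ^ 2 := by positivity
  have h6 := mul_neg_of_pos_of_neg h5 hst
  nlinarith

end GeodesicGraph

/-! ### Dual vertices along a strip, and the failure of reciprocality -/

namespace GridFrame

variable {M : Matrix (Fin 2) (Fin 2) ℝ} (B : GridFrame M) (k : ℕ)

/-- The vertex of the triangular grid at the given coordinates. -/
def vertex (m n : ℤ) : ZMod k × ZMod k := (((m + n : ℤ) : ZMod k), (n : ZMod k))

/-- The edge of the triangular grid with the given source and direction. -/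
def edge [NeZero k] (v : ZMod k × ZMod k) (c : Fin 3) : (gridTriangulation B k).E := (v, c)

/-- Every dart is plus or minus one of three vectors, and signs of determinants show that none lies
between `a` and `a + b`, between `a + b` and `b`, or between their opposites. These turns suffice
for both obstructions. -/
theorem ccwNext [NeZero k] {d d' : (gridTriangulation B k).Dart}
    (ht : (gridTriangulation B k).tail d = (gridTriangulation B k).tail d')
    (hd : ∃ r : ℝ, (r = 1 ∨ r = -1) ∧
      (((gridTriangulation B k).dartDisp d = r • B.fst k ∧
        (gridTriangulation B k).dartDisp d' = r • (B.fst k + B.snd k)) ∨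
      ((gridTriangulation B k).dartDisp d = r • (B.fst k + B.snd k) ∧
        (gridTriangulation B k).dartDisp d' = r • B.snd k))) :
    (gridTriangulation B k).CcwNext d d' := by
  have hD := B.det_fst_snd_pos k
  have hx : ∀ x : (gridTriangulation B k).Dart, ∃ q : ℝ, (q = 1 ∨ q = -1) ∧
      ((gridTriangulation B k).dartDisp x = q • B.fst k ∨
        (gridTriangulation B k).dartDisp x = q • B.snd k ∨
          (gridTriangulation B k).dartDisp x = q • (B.fst k + B.snd k)) := by
    rintro ⟨⟨v, c⟩, o⟩
    refine ⟨if o then 1 else -1, by cases o <;> simp, ?_⟩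
    have h : (gridTriangulation B k).dartDisp ((v, c), o) =
        (if o then (1 : ℝ) else -1) • (gridTriangulation B k).disp (B.edge k v c) := by
      cases o <;> simp [GeodesicGraph.dartDisp, edge]
    rw [h]
    fin_cases c
    · exact Or.inl rfl
    · exact Or.inr (Or.inl rfl)
    · exact Or.inr (Or.inr (congrArg _ (B.disp_two k v)))
  obtain ⟨r, hr, hd⟩ := hd
  apply GeodesicGraph.ccwNext_of_planeDet_pos _ ht
  · rcases hr with rfl | rfl <;> rcases hd with ⟨h1, h2⟩ | ⟨h1, h2⟩ <;> rw [h1, h2] <;>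
      simp only [planeDet_smul_left, planeDet_smul_right, planeDet_add_left, planeDet_add_right,
        planeDet_self] <;> linarith
  · intro x
    obtain ⟨q, hq, hx⟩ := hx x
    rcases hr with rfl | rfl <;> rcases hq with rfl | rfl <;> rcases hx with h | h | h <;>
      rcases hd with ⟨h1, h2⟩ | ⟨h1, h2⟩ <;> rw [h1, h2, h] <;>
      simp only [planeDet_smul_left, planeDet_smul_right, planeDet_add_left, planeDet_add_right,
        planeDet_self, planeDet_swap (B.snd k) (B.fst k)] <;> intro h1 h2 <;> linarith

theorem coverFace_eq [NeZero k] {F : (gridTriangulation B k).CoverFace} {i j m : ℤ} {p : Plane}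
    (hF : p ∈ F.1) (hp : p ∈ B.tri k i j m) : F.1 = B.tri k i j m := by
  obtain ⟨F, q, hq, rfl⟩ := F
  rw [← B.coverComponent_eq k hp]
  exact connectedComponentIn_eq hF

theorem eventually_mem_tri [NeZero k] {p q : Plane} {i j m : ℤ} {x0 y0 x1 y1 : ℝ}
    (hp : p = x0 • B.fst k + y0 • B.snd k) (hx1 : B.x k q = x1) (hy1 : B.y k q = y1)
    (hx : ((i : ℝ) < x0 ∧ x0 < i + 1) ∨ (x0 = i ∧ 0 < x1) ∨ (x0 = i + 1 ∧ x1 < 0))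
    (hy : (j : ℝ) < y0 ∧ y0 < j + 1)
    (hxy : ((m : ℝ) < x0 - y0 ∧ x0 - y0 < m + 1) ∨ (x0 - y0 = m ∧ 0 < x1 - y1) ∨
      (x0 - y0 = m + 1 ∧ x1 - y1 < 0)) :
    ∀ᶠ ε : ℝ in 𝓝[>] 0, p + ε • q ∈ B.tri k i j m := by
  have hpx : B.x k p = x0 := by rw [hp, x_combination]
  have hpy : B.y k p = y0 := by rw [hp, y_combination]
  filter_upwards [eventually_add_mul_mem_Ioo (t := x1) hx,
    eventually_add_mul_mem_Ioo (t := y1) (Or.inl hy),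
    eventually_add_mul_mem_Ioo (t := x1 - y1) hxy] with ε h1 h2 h3
  refine ⟨?_, ?_, ?_⟩
  · change B.x k (p + ε • q) ∈ _
    rwa [map_add, map_smul, hpx, hx1, smul_eq_mul]
  · change B.y k (p + ε • q) ∈ _
    rwa [map_add, map_smul, hpy, hy1, smul_eq_mul]
  · change B.x k (p + ε • q) - B.y k (p + ε • q) ∈ _
    rw [map_add, map_smul, map_add, map_smul, hpx, hx1, hpy, hy1, smul_eq_mul, smul_eq_mul]
    convert h3 using 1
    ring

/-- This and the next sign decide which triangle is to the left of an edge: `x` decreases to the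
left of a `b`-edge, `x - y` to the left of a diagonal. -/
theorem x_rot90_snd_neg [NeZero k] : B.x k (rot90 (B.snd k)) < 0 := by
  have hD := B.det_fst_snd_pos k
  have hN : 0 < ‖B.snd k‖ ^ 2 := norm_sq_pos_of_planeDet_ne_zero (v := B.fst k) (by
    rw [planeDet_swap]; linarith)
  rw [coordFst_apply, planeDet_rot90_self]
  exact div_neg_of_neg_of_pos (by linarith) hD

theorem x_sub_y_rot90_add_neg [NeZero k] :
    B.x k (rot90 (B.fst k + B.snd k)) - B.y k (rot90 (B.fst k + B.snd k)) < 0 := by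
  have hD := B.det_fst_snd_pos k
  have hN : 0 < ‖B.fst k + B.snd k‖ ^ 2 := norm_sq_pos_of_planeDet_ne_zero (v := B.snd k) (by
    rw [planeDet_add_left, planeDet_self]; linarith)
  rw [coordFst_apply, coordSnd_apply, ← sub_div]
  refine div_neg_of_neg_of_pos ?_ hD
  have := planeDet_rot90_self (B.fst k + B.snd k)
  rw [planeDet_add_right, planeDet_swap _ (B.fst k)] at this
  linarith

/-- The displacement vectors of the dual edges along a horizontal strip of the triangular grid are
the differences of consecutive dual vertices. -/
theorem exists_strip [NeZero k] {H : GeodesicGraph M} (D : (gridTriangulation B k).Duality H) :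
    ∃ f g : ℤ → Plane,
      (∀ i, H.disp (D.edge (B.edge k (vertex k i 0) 1)) = f (i - 1) - g i) ∧
      (∀ i, H.disp (D.edge (B.edge k (vertex k i 0) 2)) = g i - f i) ∧
      ∀ i, f (i + k) = f i + (k : ℝ) • B.fst k := by
  have hface : ∀ {i m : ℤ} {s t : ℝ}, (i : ℝ) < s ∧ s < i + 1 → 0 < t ∧ t < 1 →
      (m : ℝ) < s - t ∧ s - t < m + 1 →
        ∃ F : (gridTriangulation B k).CoverFace, F.1 = B.tri k i 0 m := by
    intro i m s t h1 h2 h3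
    have hp : s • B.fst k + t • B.snd k ∈ B.tri k i 0 m := by
      refine ⟨?_, ?_, ?_⟩
      · change B.x k _ ∈ _
        rwa [x_combination]
      · change B.y k _ ∈ _
        rw [y_combination]
        simpa using h2
      · change B.x k _ - B.y k _ ∈ _
        rwa [x_combination, y_combination]
    refine ⟨⟨_, s • B.fst k + t • B.snd k, ?_, (B.coverComponent_eq k hp).symm⟩, rfl⟩
    rw [compl_coverImage_eq]
    exact Set.mem_iUnion_of_mem (i, 0, m) hp
  -- In the cell with corner `(i, 0)`, the triangle below the diagonal has third index `i`, the one
  -- above it `i - 1`. The chosen points are the centroids.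
  have hlow : ∀ i : ℤ, ∃ F : (gridTriangulation B k).CoverFace, F.1 = B.tri k i 0 i := fun i =>
    hface (s := i + 2 / 3) (t := 1 / 3) (by constructor <;> linarith) (by norm_num)
      (by constructor <;> linarith)
  have hupp : ∀ i : ℤ, ∃ F : (gridTriangulation B k).CoverFace, F.1 = B.tri k i 0 (i - 1) :=
    fun i => hface (s := i + 1 / 3) (t := 2 / 3) (by constructor <;> linarith) (by norm_num)
      (by push_cast; constructor <;> linarith)
  choose low hlow using hlow
  choose upp hupp using hupp
  have hedge : ∀ (i : ℤ) (c : Fin 3) (L' R' : (gridTriangulation B k).CoverFace) (m m' : ℤ × ℤ × ℤ),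
      L'.1 = B.tri k m.1 m.2.1 m.2.2 → R'.1 = B.tri k m'.1 m'.2.1 m'.2.2 →
      (∀ᶠ ε : ℝ in 𝓝[>] 0, ((i : ℝ) • B.fst k + ((0 : ℤ) : ℝ) • B.snd k) +
        (1 / 2 : ℝ) • (gridTriangulation B k).disp (B.edge k (vertex k i 0) c) +
          ε • rot90 ((gridTriangulation B k).disp (B.edge k (vertex k i 0) c)) ∈
            B.tri k m.1 m.2.1 m.2.2) →
      (∀ᶠ ε : ℝ in 𝓝[>] 0, ((i : ℝ) • B.fst k + ((0 : ℤ) : ℝ) • B.snd k) +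
        (1 / 2 : ℝ) • (gridTriangulation B k).disp (B.edge k (vertex k i 0) c) +
          ε • (-rot90 ((gridTriangulation B k).disp (B.edge k (vertex k i 0) c))) ∈
            B.tri k m'.1 m'.2.1 m'.2.2) →
      H.disp (D.edge (B.edge k (vertex k i 0) c)) = D.lift L' - D.lift R' := by
    intro i c L' R' m m' hLt hRt hL hR
    obtain ⟨L, R, -, -, hL', hR', -, -, -, -, h⟩ := D.dual_edge (B.edge k (vertex k i 0) c)
      ((i : ℝ) • B.fst k + ((0 : ℤ) : ℝ) • B.snd k) (B.pos_intCast k i 0).symm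
    -- A single common point identifies the face supplied by the duality with the explicit triangle.
    obtain ⟨ε, h1, h2⟩ := (hL'.and hL).exists
    obtain ⟨δ, h4, h5⟩ := (hR'.and hR).exists
    rw [smul_neg, ← sub_eq_add_neg] at h5
    have e1 : L = L' := Subtype.ext ((B.coverFace_eq k h1 h2).trans hLt.symm)
    have e2 : R = R' := Subtype.ext ((B.coverFace_eq k h4 h5).trans hRt.symm)
    rw [h, e1, e2]
  have hb := B.x_rot90_snd_neg k
  have hc := B.x_sub_y_rot90_add_neg k
  refine ⟨fun i => D.lift (low i), fun i => D.lift (upp i), fun i => ?_, fun i => ?_, fun i => ?_⟩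
  -- The `b`-edge at `x = i` separates the lower triangle of cell `i - 1`, on its left, from the
  -- upper triangle of cell `i`.
  · refine hedge i 1 _ _ (i - 1, 0, i - 1) (i, 0, i - 1) (hlow _) (hupp _) ?_ ?_
    · refine B.eventually_mem_tri k (x0 := i) (y0 := 1 / 2) ?_ rfl rfl (Or.inr (Or.inr ⟨?_, hb⟩))
        (by norm_num) (Or.inl ?_)
      · rw [edge, disp_one]
        simp
      · push_cast; ring
      · push_cast; constructor <;> linarith
    · refine B.eventually_mem_tri k (x0 := i) (y0 := 1 / 2) ?_ rfl rfl (Or.inr (Or.inl ⟨rfl, ?_⟩))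
        (by norm_num) (Or.inl ?_)
      · rw [edge, disp_one]
        simp
      · rw [map_neg]
        exact neg_pos.mpr hb
      · push_cast; constructor <;> linarith
  · refine hedge i 2 _ _ (i, 0, i - 1) (i, 0, i) (hupp _) (hlow _) ?_ ?_
    · refine B.eventually_mem_tri k (x0 := i + 1 / 2) (y0 := 1 / 2) ?_ rfl rfl (Or.inl ?_)
        (by norm_num) (Or.inr (Or.inr ⟨?_, ?_⟩))
      · rw [edge, disp_two]
        simp
        module
      · constructor <;> linarith
      · push_cast; ring
      · rw [edge, disp_two]
        exact hc
    · refine B.eventually_mem_tri k (x0 := i + 1 / 2) (y0 := 1 / 2) ?_ rfl rfl (Or.inl ?_)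
        (by norm_num) (Or.inr (Or.inl ⟨?_, ?_⟩))
      · rw [edge, disp_two]
        simp
        module
      · constructor <;> linarith
      · ring
      · rw [edge, disp_two, map_neg, map_neg]
        linarith
  · have hl : (k : ℝ) • B.fst k ∈ lattice M := (B.mem_lattice_iff_coord k _).mpr
      ⟨1, 0, by rw [map_smul, x_fst]; simp, by rw [map_smul, y_fst]; simp⟩
    refine D.lift_translate _ _ _ hl ?_
    rw [hlow, hlow, B.tri_translate k (r := k) (s := 0) (by rw [map_smul, x_fst]; simp)
      (by rw [map_smul, y_fst]; simp)]
    simp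

theorem tail_edge_true [NeZero k] (v : ZMod k × ZMod k) (c : Fin 3) :
    (gridTriangulation B k).tail (B.edge k v c, true) = v := rfl

theorem tail_edge_false [NeZero k] (v : ZMod k × ZMod k) (c : Fin 3) :
    (gridTriangulation B k).tail (B.edge k v c, false) = v + edgeStep k c := rfl

/-- The dual edges of adjacent edges in a horizontal strip are rotated in the same sense. -/
theorem strip_mul_pos [NeZero k] {H : GeodesicGraph M} {D : (gridTriangulation B k).Duality H}
    {u : (gridTriangulation B k).E → ℝ} (hu : ∀ e, u e ≠ 0)
    (hD : ∀ e, H.disp (D.edge e) = u e • rot90 ((gridTriangulation B k).disp e)) (i : ℤ) :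
    0 < u (B.edge k (vertex k i 0) 1) * u (B.edge k (vertex k i 0) 2) ∧
      0 < u (B.edge k (vertex k (i + 1) 0) 1) * u (B.edge k (vertex k i 0) 2) := by
  have hdet := B.det_fst_snd_pos k
  have h0 : ∀ v, H.disp (D.edge (B.edge k v 0)) = u (B.edge k v 0) • rot90 (B.fst k) :=
    fun v => hD _
  have h1 : ∀ v, H.disp (D.edge (B.edge k v 1)) = u (B.edge k v 1) • rot90 (B.snd k) :=
    fun v => hD _
  have h2 : ∀ v, H.disp (D.edge (B.edge k v 2)) =
      u (B.edge k v 2) • rot90 (B.fst k + B.snd k) :=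
    fun v => (hD _).trans (by rw [edge, disp_two])
  constructor
  -- The upper triangle of cell `i`: its horizontal edge is on the line `y = 1`.
  · refine GeodesicGraph.mul_pos_of_ccwNext hdet (hu (B.edge k (vertex k i 1) 0)) (hu _) (hu _)
      (h0 _) (h1 _) (h2 _) true ?_ ?_
    · refine D.orientation (B.edge k (vertex k i 0) 1, true) (B.edge k (vertex k i 0) 2, true)
        (B.ccwNext k rfl ⟨1, Or.inl rfl, Or.inr ⟨?_, ?_⟩⟩)
      · rw [one_smul]; exact B.disp_two k _
      · rw [one_smul]; exact B.disp_one k _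
    · refine D.orientation (B.edge k (vertex k i 0) 2, false) (B.edge k (vertex k i 1) 0, false)
        (B.ccwNext k ?_ ⟨-1, Or.inr rfl, Or.inl ⟨?_, ?_⟩⟩)
      · rw [tail_edge_false, tail_edge_false]
        refine Prod.ext ?_ ?_ <;> simp [vertex, edgeStep]
        ring
      · rw [neg_one_smul]; exact congrArg Neg.neg (B.disp_zero k _)
      · rw [neg_one_smul]; exact congrArg Neg.neg (B.disp_two k _)
  -- The lower triangle of cell `i`, whose `b`-edge starts at `i + 1`; all its darts are reversed
  -- with respect to the upper one.
  · refine GeodesicGraph.mul_pos_of_ccwNext hdet (hu (B.edge k (vertex k i 0) 0)) (hu _) (hu _)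
      (h0 _) (h1 _) (h2 _) false ?_ ?_
    · refine D.orientation (B.edge k (vertex k (i + 1) 0) 1, false)
        (B.edge k (vertex k i 0) 2, false)
        (B.ccwNext k ?_ ⟨-1, Or.inr rfl, Or.inr ⟨?_, ?_⟩⟩)
      · rw [tail_edge_false, tail_edge_false]
        refine Prod.ext ?_ ?_ <;> simp [vertex, edgeStep]
        ring
      · rw [neg_one_smul]; exact congrArg Neg.neg (B.disp_two k _)
      · rw [neg_one_smul]; exact congrArg Neg.neg (B.disp_one k _)
    · refine D.orientation (B.edge k (vertex k i 0) 2, true) (B.edge k (vertex k i 0) 0, true)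
        (B.ccwNext k rfl ⟨1, Or.inl rfl, Or.inl ⟨?_, ?_⟩⟩)
      · rw [one_smul]; exact B.disp_zero k _
      · rw [one_smul]; exact B.disp_two k _

theorem not_isReciprocal [NeZero k] : ¬ (gridTriangulation B k).IsReciprocal := by
  rintro ⟨H, D, hH, hperp⟩
  have hdet := B.det_fst_snd_pos k
  have hin := B.inner_fst_snd_pos k
  have hk : (0 : ℝ) < k := Nat.cast_pos.mpr (NeZero.pos k)
  choose u hu using fun e => exists_smul_rot90_of_inner_eq_zero ((B.isEmbedding k).disp_ne_zero e)
    (hperp e)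
  have hu0 : ∀ e, u e ≠ 0 := fun e h0 => hH.disp_ne_zero (D.edge e) (by rw [hu, h0, zero_smul])
  obtain ⟨f, g, hf, hg, hfk⟩ := B.exists_strip k D
  set s : ℕ → ℝ := fun i => u (B.edge k (vertex k i 0) 1) with hs
  set t : ℕ → ℝ := fun i => u (B.edge k (vertex k i 0) 2) with ht
  have hstep : ∀ i : ℕ, s i • rot90 (B.snd k) + t i • rot90 (B.fst k + B.snd k) =
      f ((i : ℤ) - 1) - f (((i + 1 : ℕ) : ℤ) - 1) := fun i => by
    have h1 := (hu (B.edge k (vertex k i 0) 1)).symm.trans (hf i)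
    have h2 := (hu (B.edge k (vertex k i 0) 2)).symm.trans (hg i)
    rw [edge, disp_one] at h1
    rw [edge, disp_two] at h2
    change s i • rot90 (B.snd k) = _ at h1
    change t i • rot90 (B.fst k + B.snd k) = _ at h2
    rw [h1, h2]
    simp
  have hsum : (∑ i ∈ Finset.range k, s i) • rot90 (B.snd k) +
      (∑ i ∈ Finset.range k, t i) • rot90 (B.fst k + B.snd k) = -((k : ℝ) • B.fst k) := by
    rw [Finset.sum_smul, Finset.sum_smul, ← Finset.sum_add_distrib,
      Finset.sum_congr rfl fun i _ => hstep i,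
      Finset.sum_range_sub' fun i : ℕ => f ((i : ℤ) - 1)]
    -- The telescoping sum is `f (-1) - f (k - 1)`, one period of the strip.
    have := hfk (-1)
    rw [neg_add_eq_sub] at this
    rw [this]
    simp
  have hst : ∀ i : ℕ, 0 < s i * t i ∧ 0 < s (i + 1) * t i := fun i => by
    have := B.strip_mul_pos k hu0 hu i
    simpa [hs, ht] using this
  -- Pairing with `b` removes the rotated `b`; pairing with `a + b`, below, removes the rotated `a +
  -- b`.
  have e1 : (∑ i ∈ Finset.range k, t i) < 0 := by
    have h := congrArg (fun v => inner ℝ v (B.snd k)) hsum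
    simp only [inner_add_left, real_inner_smul_left, inner_neg_left, inner_rot90_left,
      planeDet_self, planeDet_add_left] at h
    have h2 := mul_pos hk hin
    by_contra! hle
    have := mul_nonneg hle hdet.le
    linarith
  have e2 : 0 < ∑ i ∈ Finset.range k, s i := by
    have h := congrArg (fun v => inner ℝ v (B.fst k + B.snd k)) hsum
    simp only [real_inner_smul_left, inner_neg_left, inner_add_left, inner_rot90_left,
      planeDet_self] at h
    rw [inner_add_right, planeDet_add_right, planeDet_self, planeDet_swap] at h
    have h2 := mul_pos hk hin
    have h3 : 0 ≤ (k : ℝ) * inner ℝ (B.fst k) (B.fst k) := mul_nonneg hk.le real_inner_self_nonneg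
    by_contra! hle
    have := mul_nonneg (neg_nonneg.mpr hle) hdet.le
    linarith
  -- The sign of `s 0` propagates to `t 0`, `s 1`, `t 1`, and so on; either sign contradicts one of
  -- the two sums.
  rcases lt_or_gt_of_ne (hu0 (B.edge k (vertex k (0 : ℕ) 0) 1)) with h0 | h0
  · have hneg : ∀ i : ℕ, s i < 0 := fun i => by
      induction i with
      | zero => exact h0
      | succ i ih =>
        exact neg_of_mul_pos_left (hst i).2 (neg_of_mul_pos_right (hst i).1 ih.le).le
    exact e2.not_ge (Finset.sum_nonpos fun i _ => (hneg i).le)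
  · have hpos : ∀ i : ℕ, 0 < s i := fun i => by
      induction i with
      | zero => exact h0
      | succ i ih =>
        exact pos_of_mul_pos_left (hst i).2 (pos_of_mul_pos_right (hst i).1 ih.le).le
    exact e1.not_ge (Finset.sum_nonneg fun i _ => (pos_of_mul_pos_right (hst i).1 (hpos i).le).le)

theorem not_isReciprocalStress [NeZero k] (ω : (gridTriangulation B k).E → ℝ) :
    ¬ (gridTriangulation B k).IsReciprocalStress ω :=
  fun ⟨H, D, h, _⟩ => B.not_isReciprocal k ⟨H, D, h⟩

end GridFrame

/-! ### Equilibrium stresses and the failure of coherence -/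

namespace GridFrame

variable {M : Matrix (Fin 2) (Fin 2) ℝ} (B : GridFrame M) (k : ℕ)

/-- For each direction, exactly one edge leaves and one enters each vertex, and their contributions
cancel. Summing over darts also covers loops. -/
theorem isEquilibriumStress [NeZero k] {ω : (gridTriangulation B k).E → ℝ}
    (h : ∀ e e', (gridTriangulation B k).disp e = (gridTriangulation B k).disp e' → ω e = ω e') :
    (gridTriangulation B k).IsEquilibriumStress ω := by
  classical
  intro p
  have hω : ∀ v c, ω (B.edge k v c) = ω (B.edge k 0 c) := fun v c => h _ _ rfl
  rw [Finset.sum_filter]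
  change ∑ d : ((ZMod k × ZMod k) × Fin 3) × Bool, _ = _
  rw [Fintype.sum_prod_type, Fintype.sum_prod_type_right]
  refine Finset.sum_eq_zero fun c _ => ?_
  have key : ∀ v : ZMod k × ZMod k, ∑ o : Bool,
      (if (gridTriangulation B k).tail (B.edge k v c, o) = p then
        ω (B.edge k v c) • (gridTriangulation B k).dartDisp (B.edge k v c, o) else 0) =
      (if v = p then ω (B.edge k 0 c) • (gridTriangulation B k).disp (B.edge k 0 c) else 0) -
      (if v + edgeStep k c = p then
        ω (B.edge k 0 c) • (gridTriangulation B k).disp (B.edge k 0 c) else 0) := by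
    intro v
    rw [Fintype.sum_bool, hω, tail_edge_true, tail_edge_false, GeodesicGraph.dartDisp_true,
      GeodesicGraph.dartDisp_false, sub_eq_add_neg, smul_neg]
    exact congrArg₂ (· + ·) (if_congr Iff.rfl rfl rfl)
      ((if_congr Iff.rfl rfl neg_zero.symm).trans (apply_ite Neg.neg _ _ _).symm)
  refine (Finset.sum_congr rfl fun v _ => key v).trans ?_
  rw [Finset.sum_sub_distrib, sub_eq_zero]
  exact (Equiv.sum_comp (Equiv.addRight (edgeStep k c)) fun v => if v = p then
    ω (B.edge k 0 c) • (gridTriangulation B k).disp (B.edge k 0 c) else 0).symm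

/-- The local condition at the diagonals, summed over all vertices, is already contradictory: grid
shifts permute the vertices, so the weights cancel. -/
theorem not_isCoherent [NeZero k] : ¬ (gridTriangulation B k).IsCoherent := by
  rintro ⟨w, hw, -⟩
  have hdet := B.det_fst_snd_pos k
  have hin := B.inner_fst_snd_pos k
  obtain ⟨w, key⟩ : ∃ w : ZMod k × ZMod k → ℝ, ∀ v, 0 < -inner ℝ (B.fst k) (B.snd k) +
      (w v - w (v + edgeStep k 0)) - (w (v + edgeStep k 1) - w (v + edgeStep k 2)) := by
    refine ⟨w, fun v => ?_⟩
    have h := hw (B.edge k v 2, true) (B.edge k v 0, true) (B.edge k v 1, true)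
      (B.ccwNext k rfl ⟨1, Or.inl rfl, Or.inl ⟨?_, ?_⟩⟩)
      (B.ccwNext k rfl ⟨1, Or.inl rfl, Or.inr ⟨?_, ?_⟩⟩)
    · have r0 : (gridTriangulation B k).delaunayRow w (B.edge k v 0, true) = ![B.fst k 0, B.fst k 1,
          (1 / 2) * ‖B.fst k‖ ^ 2 + w v - w (v + edgeStep k 0)] := rfl
      have r1 : (gridTriangulation B k).delaunayRow w (B.edge k v 1, true) = ![B.snd k 0, B.snd k 1,
          (1 / 2) * ‖B.snd k‖ ^ 2 + w v - w (v + edgeStep k 1)] := rfl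
      have r2 : (gridTriangulation B k).delaunayRow w (B.edge k v 2, true) =
          ![(B.fst k + B.snd k) 0, (B.fst k + B.snd k) 1,
            (1 / 2) * ‖B.fst k + B.snd k‖ ^ 2 + w v - w (v + edgeStep k 2)] := by
        rw [GeodesicGraph.delaunayRow, GeodesicGraph.dartDisp_true, edge, disp_two]
        rfl
      rw [r0, r1, r2, Matrix.det_fin_three, plane_norm_sq_eq, plane_norm_sq_eq,
        plane_norm_sq_eq] at h
      -- The Delaunay determinant is the bracket in `key` times `planeDet` of the two grid vectors.
      refine pos_of_mul_pos_left ?_ hdet.le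
      refine h.trans_eq ?_
      rw [plane_inner_eq]
      simp [planeDet]
      ring
    · rw [one_smul]; exact B.disp_zero k _
    · rw [one_smul]; exact B.disp_two k _
    · rw [one_smul]; exact B.disp_two k _
    · rw [one_smul]; exact B.disp_one k _
  have hsum := Finset.sum_pos (fun v (_ : v ∈ (Finset.univ : Finset (ZMod k × ZMod k))) => key v)
    Finset.univ_nonempty
  have hc : ∀ c, ∑ v : ZMod k × ZMod k, w (v + edgeStep k c) = ∑ v : ZMod k × ZMod k, w v :=
    fun c => Equiv.sum_comp (Equiv.addRight (edgeStep k c)) w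
  rw [Finset.sum_sub_distrib, Finset.sum_add_distrib, Finset.sum_sub_distrib,
    Finset.sum_sub_distrib, hc, hc, hc, sub_self, add_zero, sub_zero, Finset.sum_const,
    smul_neg, Left.neg_pos_iff] at hsum
  exact hsum.not_ge (nsmul_nonneg hin.le _)

/-! ### Frames of the square torus and of arbitrary flat tori -/

/-- The standard frame of the square flat torus. -/
def square : GridFrame 1 where
  toLin := LinearMap.id
  mem_lattice x := by simp
  det_pos := by simp [planeDet, edgeVector]
  inner_pos := by simp [plane_inner_eq, edgeVector]

theorem coverTriangulation_eq [NeZero k] :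
    coverTriangulation k = gridTriangulation square k := rfl

/-- A frame from a basis of the lattice of `M`. -/
def ofBasis (a b : Plane) (hab : ∀ x, x ∈ lattice M ↔ ∃ m n : ℤ, x = (m : ℝ) • a + (n : ℝ) • b)
    (hdet : 0 < planeDet a b) (hin : 0 < inner ℝ a b) : GridFrame M where
  toLin :=
    -- The second unit vector goes to `b - a` so that `(1, 1)` goes to `b`.
    { toFun := fun x => x 0 • a + x 1 • (b - a)
      map_add' := fun x y => by simp only [PiLp.add_apply]; module
      map_smul' := fun r x => by simp only [PiLp.smul_apply, smul_eq_mul, RingHom.id_apply]; module }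
  mem_lattice x := by
    rw [hab]
    constructor
    · rintro ⟨m, n, rfl⟩
      refine ⟨_, mem_lattice_iff.mpr ⟨m + n, n, rfl⟩, ?_⟩
      simp
      module
    · rintro ⟨y, hy, rfl⟩
      obtain ⟨m, n, rfl⟩ := mem_lattice_iff.mp hy
      refine ⟨m - n, n, ?_⟩
      simp
      module
  det_pos := by simpa [edgeVector] using hdet
  inner_pos := by simpa [edgeVector] using hin

/-- Adding a large multiple of `p` to `q` keeps the lattice and the determinant and makes the angle
acute. If the orientation is negative, exchanging the two vectors repairs it without affecting the
angle. -/
theorem nonempty_of_det_ne_zero (hM : M.det ≠ 0) : Nonempty (GridFrame M) := by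
  set p : Plane := !₂[M 0 0, M 1 0] with hp
  set q : Plane := !₂[M 0 1, M 1 1] with hq
  have hpq : planeDet p q ≠ 0 := by
    rw [Matrix.det_fin_two] at hM
    simp only [planeDet, hp, hq]
    simp
    intro h
    exact hM (by linarith)
  have hN : 0 < ‖p‖ ^ 2 := norm_sq_pos_of_planeDet_ne_zero hpq
  obtain ⟨r, hr⟩ := exists_nat_gt (-inner ℝ p q / ‖p‖ ^ 2)
  rw [div_lt_iff₀ hN] at hr
  have hin : 0 < inner ℝ p (q + (r : ℝ) • p) := by
    rw [inner_add_right, real_inner_smul_right, real_inner_self_eq_norm_sq]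
    linarith
  have hdet : planeDet p (q + (r : ℝ) • p) = planeDet p q := by
    rw [planeDet_add_right, planeDet_smul_right, planeDet_self, mul_zero, add_zero]
  have hlat : ∀ x, x ∈ lattice M ↔
      ∃ m n : ℤ, x = (m : ℝ) • p + (n : ℝ) • (q + (r : ℝ) • p) := fun x => by
    rw [mem_lattice_iff]
    constructor
    · rintro ⟨m, n, rfl⟩
      refine ⟨m - n * r, n, ?_⟩
      push_cast
      module
    · rintro ⟨m, n, rfl⟩
      refine ⟨m + n * r, n, ?_⟩
      push_cast
      module
  rcases lt_or_gt_of_ne hpq with h | h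
  · refine ⟨ofBasis (q + (r : ℝ) • p) p (fun x => ?_) ?_ ?_⟩
    · rw [hlat, exists_comm]
      simp only [add_comm]
    · rw [planeDet_swap, hdet]
      linarith
    · rwa [real_inner_comm]
  · exact ⟨ofBasis p (q + (r : ℝ) • p) hlat (by rwa [hdet]) hin⟩

end GridFrame

end

theorem mainTheorem4 :
    (∀ (k : ℕ) [NeZero k],
      (coverTriangulation k).IsTorusGraph ∧
      (∀ ω : (coverTriangulation k).E → ℝ,
        (∀ e e', (coverTriangulation k).disp e = (coverTriangulation k).disp e' → ω e = ω e') →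
          (coverTriangulation k).IsEquilibriumStress ω) ∧
      (∀ ω : (coverTriangulation k).E → ℝ, ¬ (coverTriangulation k).IsReciprocalStress ω) ∧
      ¬ (coverTriangulation k).IsReciprocal ∧
      ¬ (coverTriangulation k).IsCoherent) ∧
    (∀ M : Matrix (Fin 2) (Fin 2) ℝ, M.det ≠ 0 →
      ∃ G : GeodesicGraph M, G.IsTorusGraph ∧ G.IsEquilibrium ∧
        (∃ ω : G.E → ℝ, (∀ e, 0 < ω e) ∧ G.IsEquilibriumStress ω ∧ ¬ G.IsReciprocalStress ω) ∧
        ¬ G.IsReciprocal ∧ ¬ G.IsCoherent) := by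
  constructor
  · intro k _
    rw [GridFrame.coverTriangulation_eq]
    exact ⟨⟨GridFrame.square.isEmbedding k, GridFrame.square.isCellular k⟩,
      fun ω => GridFrame.square.isEquilibriumStress k, GridFrame.square.not_isReciprocalStress k,
      GridFrame.square.not_isReciprocal k, GridFrame.square.not_isCoherent k⟩
  · intro M hM
    obtain ⟨B⟩ := GridFrame.nonempty_of_det_ne_zero hM
    have h : (gridTriangulation B 1).IsEquilibriumStress fun _ => 1 :=
      B.isEquilibriumStress 1 fun _ _ _ => rfl
    exact ⟨gridTriangulation B 1, ⟨B.isEmbedding 1, B.isCellular 1⟩, ⟨_, fun _ => one_pos, h⟩,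
      ⟨_, fun _ => one_pos, h, B.not_isReciprocalStress 1 _⟩, B.not_isReciprocal 1,
      B.not_isCoherent 1⟩
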